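/- Let $\mathbb{D}$ be the division ring of rational quaternions, with standard units $\mathbf{i},\mathbf{j},\mathbf{k}$ and norm $N(a_0+a_1\mathbf{i}+a_2\mathbf{j}+a_3\mathbf{k})=a_0^2+a_1^2+a_2^2+a_3^2$. Let $\mathbf{L}\subseteq\mathbb{D}$ be the ring of Lipschitz quaternions (all $a_i\in\mathbb{Z}$), and let $\mathbf{H}\subseteq\mathbb{D}$ be the ring of Hurwitz quaternions (all $a_i\in\mathbb{Z}$, or all $a_i\in\mathbb{Z}+\tfrac12$). Let $R$ be $\mathbf{L}$ or $\mathbf{H}$. In $\mathbb{D}[x]$ the indeterminate $x$ is central, and polynomials are evaluated with the coefficients on the left: if $f=\sum_i a_ix^i$, then $f(\alpha)=\sum_i a_i\alpha^i$. For $S\subseteq R$ put $\mathrm{Int}(S,R)=\{f\in\mathbb{D}[x] : f(\alpha)\in R \text{ for all } \alpha\in S\}$. The set $S$ is a *ringset* of $R$ if $\mathrm{Int}(S,R)$ is a subring of $\mathbb{D}[x]$. The set $S$ is *reduced* (with respect to $R$) if (i) there is a monic quadratic polynomial $m\in\mathbb{Z}[x]$ such that every element of $S$ has minimal polynomial $m$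 over $\mathbb{Q}$, and (ii) for all $a,n\in\mathbb{Z}$ with $n\ge 2$, the set $S+a=\{\alpha+a : \alpha\in S\}$ is not contained in $nR$. **Theorem.** Let $S\subsetneq R$ be reduced with $|S|\ge 2$. Let $\Delta(S)=\{\alpha-\beta : \alpha,\beta\in S\}$ and $\Gamma(S)=\gcd\{N(\delta) : \delta\in\Delta(S)\}$. 1. If $R=\mathbf{L}$, then $S$ is a ringset of $R$ if and only if $\Gamma(S)=2$; or $\Gamma(S)=4$; or $\Gamma(S)=8$ and there exist $\delta_1,\delta_2\in\Delta(S)$ that are congruent modulo $4\mathbf{L}$ to two distinct members of $\{2\mathbf{i}+2\mathbf{j},\ 2\mathbf{i}+2\mathbf{k},\ 2\mathbf{j}+2\mathbf{k}\}$. 2. If $R=\mathbf{H}$, then $S$ is a ringset of $R$ if and only if $\Gamma(S)=1$ or $\Gamma(S)=2$. -/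

import Mathlib

namespace QuatRingset

/-- The quaternion unit `i` in the division ring of rational quaternions. -/
def qi : Quaternion ℚ := ⟨0, 1, 0, 0⟩

/-- The quaternion unit `j`. -/
def qj : Quaternion ℚ := ⟨0, 0, 1, 0⟩

/-- The quaternion unit `k`. -/
def qk : Quaternion ℚ := ⟨0, 0, 0, 1⟩

/-- The ring `L` of Lipschitz quaternions: all coefficients are integers. -/
def lipschitz : Subring (Quaternion ℚ) where
  carrier := {α | ∃ a₀ a₁ a₂ a₃ : ℤ, α.re = a₀ ∧ α.imI = a₁ ∧ α.imJ = a₂ ∧ α.imK = a₃}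
  mul_mem' := by
    rintro _ _ ⟨a₀, a₁, a₂, a₃, ha₀, ha₁, ha₂, ha₃⟩ ⟨b₀, b₁, b₂, b₃, hb₀, hb₁, hb₂, hb₃⟩
    refine ⟨a₀ * b₀ - a₁ * b₁ - a₂ * b₂ - a₃ * b₃, a₀ * b₁ + a₁ * b₀ + a₂ * b₃ - a₃ * b₂,
      a₀ * b₂ - a₁ * b₃ + a₂ * b₀ + a₃ * b₁, a₀ * b₃ + a₁ * b₂ - a₂ * b₁ + a₃ * b₀, ?_, ?_, ?_, ?_⟩
    all_goals
      simp only [Quaternion.re_mul, Quaternion.imI_mul, Quaternion.imJ_mul,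
        Quaternion.imK_mul, ha₀, ha₁, ha₂, ha₃, hb₀, hb₁, hb₂, hb₃]
      push_cast; ring
  one_mem' := ⟨1, 0, 0, 0,
    by simp [Quaternion.re_one], by simp [Quaternion.imI_one], by simp [Quaternion.imJ_one],
    by simp [Quaternion.imK_one]⟩
  add_mem' := by
    rintro _ _ ⟨a₀, a₁, a₂, a₃, ha₀, ha₁, ha₂, ha₃⟩ ⟨b₀, b₁, b₂, b₃, hb₀, hb₁, hb₂, hb₃⟩
    exact ⟨a₀ + b₀, a₁ + b₁, a₂ + b₂, a₃ + b₃,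
        by rw [Quaternion.re_add, ha₀, hb₀]; push_cast; ring,
        by rw [Quaternion.imI_add, ha₁, hb₁]; push_cast; ring,
        by rw [Quaternion.imJ_add, ha₂, hb₂]; push_cast; ring,
        by rw [Quaternion.imK_add, ha₃, hb₃]; push_cast; ring⟩
  zero_mem' := ⟨0, 0, 0, 0,
    by simp [Quaternion.re_zero], by simp [Quaternion.imI_zero], by simp [Quaternion.imJ_zero],
    by simp [Quaternion.imK_zero]⟩
  neg_mem' := by
    rintro _ ⟨a₀, a₁, a₂, a₃, ha₀, ha₁, ha₂, ha₃⟩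
    exact ⟨-a₀, -a₁, -a₂, -a₃,
        by rw [Quaternion.re_neg, ha₀]; push_cast; ring,
        by rw [Quaternion.imI_neg, ha₁]; push_cast; ring,
        by rw [Quaternion.imJ_neg, ha₂]; push_cast; ring,
        by rw [Quaternion.imK_neg, ha₃]; push_cast; ring⟩

/-- The ring `H` of Hurwitz quaternions: the coefficients are all in `ℤ`
or all in `ℤ + 1/2`. -/
def hurwitz : Subring (Quaternion ℚ) where
  carrier := {α | (∃ a₀ a₁ a₂ a₃ : ℤ, α.re = a₀ ∧ α.imI = a₁ ∧ α.imJ = a₂ ∧ α.imK = a₃) ∨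
    ∃ a₀ a₁ a₂ a₃ : ℤ, α.re = a₀ + 1 / 2 ∧ α.imI = a₁ + 1 / 2 ∧
      α.imJ = a₂ + 1 / 2 ∧ α.imK = a₃ + 1 / 2}
  mul_mem' := by
    rintro _ _ (⟨a₀, a₁, a₂, a₃, ha₀, ha₁, ha₂, ha₃⟩ | ⟨a₀, a₁, a₂, a₃, ha₀, ha₁, ha₂, ha₃⟩)
      (⟨b₀, b₁, b₂, b₃, hb₀, hb₁, hb₂, hb₃⟩ | ⟨b₀, b₁, b₂, b₃, hb₀, hb₁, hb₂, hb₃⟩)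
    · refine Or.inl ⟨a₀ * b₀ - a₁ * b₁ - a₂ * b₂ - a₃ * b₃,
        a₀ * b₁ + a₁ * b₀ + a₂ * b₃ - a₃ * b₂, a₀ * b₂ - a₁ * b₃ + a₂ * b₀ + a₃ * b₁,
        a₀ * b₃ + a₁ * b₂ - a₂ * b₁ + a₃ * b₀, ?_, ?_, ?_, ?_⟩
      all_goals
        simp only [Quaternion.re_mul, Quaternion.imI_mul, Quaternion.imJ_mul,
          Quaternion.imK_mul, ha₀, ha₁, ha₂, ha₃, hb₀, hb₁, hb₂, hb₃]
        push_cast; ring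
    · obtain ⟨t, ht | ht⟩ := Int.even_or_odd' (a₀ + a₁ + a₂ + a₃)
      · have h : (a₀ : ℚ) + a₁ + a₂ + a₃ = 2 * t := by exact_mod_cast ht
        refine Or.inl ⟨a₀ * b₀ - a₁ * b₁ - a₂ * b₂ - a₃ * b₃ + a₀ - t,
          a₀ * b₁ + a₁ * b₀ + a₂ * b₃ - a₃ * b₂ + t - a₃,
          a₀ * b₂ - a₁ * b₃ + a₂ * b₀ + a₃ * b₁ + t - a₁,
          a₀ * b₃ + a₁ * b₂ - a₂ * b₁ + a₃ * b₀ + t - a₂, ?_, ?_, ?_, ?_⟩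
        all_goals
          simp only [Quaternion.re_mul, Quaternion.imI_mul, Quaternion.imJ_mul,
            Quaternion.imK_mul, ha₀, ha₁, ha₂, ha₃, hb₀, hb₁, hb₂, hb₃]
          push_cast; linarith
      · have h : (a₀ : ℚ) + a₁ + a₂ + a₃ = 2 * t + 1 := by exact_mod_cast ht
        refine Or.inr ⟨a₀ * b₀ - a₁ * b₁ - a₂ * b₂ - a₃ * b₃ + a₀ - t - 1,
          a₀ * b₁ + a₁ * b₀ + a₂ * b₃ - a₃ * b₂ + t - a₃,
          a₀ * b₂ - a₁ * b₃ + a₂ * b₀ + a₃ * b₁ + t - a₁,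
          a₀ * b₃ + a₁ * b₂ - a₂ * b₁ + a₃ * b₀ + t - a₂, ?_, ?_, ?_, ?_⟩
        all_goals
          simp only [Quaternion.re_mul, Quaternion.imI_mul, Quaternion.imJ_mul,
            Quaternion.imK_mul, ha₀, ha₁, ha₂, ha₃, hb₀, hb₁, hb₂, hb₃]
          push_cast; linarith
    · obtain ⟨t, ht | ht⟩ := Int.even_or_odd' (b₀ + b₁ + b₂ + b₃)
      · have h : (b₀ : ℚ) + b₁ + b₂ + b₃ = 2 * t := by exact_mod_cast ht
        refine Or.inl ⟨a₀ * b₀ - a₁ * b₁ - a₂ * b₂ - a₃ * b₃ + b₀ - t,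
          a₀ * b₁ + a₁ * b₀ + a₂ * b₃ - a₃ * b₂ + t - b₂,
          a₀ * b₂ - a₁ * b₃ + a₂ * b₀ + a₃ * b₁ + t - b₃,
          a₀ * b₃ + a₁ * b₂ - a₂ * b₁ + a₃ * b₀ + t - b₁, ?_, ?_, ?_, ?_⟩
        all_goals
          simp only [Quaternion.re_mul, Quaternion.imI_mul, Quaternion.imJ_mul,
            Quaternion.imK_mul, ha₀, ha₁, ha₂, ha₃, hb₀, hb₁, hb₂, hb₃]
          push_cast; linarith
      · have h : (b₀ : ℚ) + b₁ + b₂ + b₃ = 2 * t + 1 := by exact_mod_cast ht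
        refine Or.inr ⟨a₀ * b₀ - a₁ * b₁ - a₂ * b₂ - a₃ * b₃ + b₀ - t - 1,
          a₀ * b₁ + a₁ * b₀ + a₂ * b₃ - a₃ * b₂ + t - b₂,
          a₀ * b₂ - a₁ * b₃ + a₂ * b₀ + a₃ * b₁ + t - b₃,
          a₀ * b₃ + a₁ * b₂ - a₂ * b₁ + a₃ * b₀ + t - b₁, ?_, ?_, ?_, ?_⟩
        all_goals
          simp only [Quaternion.re_mul, Quaternion.imI_mul, Quaternion.imJ_mul,
            Quaternion.imK_mul, ha₀, ha₁, ha₂, ha₃, hb₀, hb₁, hb₂, hb₃]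
          push_cast; linarith
    · obtain ⟨t, ht | ht⟩ :=
        Int.even_or_odd' (a₀ + a₁ + a₂ + a₃ + (b₀ + b₁ + b₂ + b₃))
      · have h : (a₀ : ℚ) + a₁ + a₂ + a₃ + (b₀ + b₁ + b₂ + b₃) = 2 * t := by
          exact_mod_cast ht
        refine Or.inr ⟨a₀ * b₀ - a₁ * b₁ - a₂ * b₂ - a₃ * b₃ + a₀ + b₀ - t - 1,
          a₀ * b₁ + a₁ * b₀ + a₂ * b₃ - a₃ * b₂ + t - a₃ - b₂,
          a₀ * b₂ - a₁ * b₃ + a₂ * b₀ + a₃ * b₁ + t - a₁ - b₃,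
          a₀ * b₃ + a₁ * b₂ - a₂ * b₁ + a₃ * b₀ + t - a₂ - b₁, ?_, ?_, ?_, ?_⟩
        all_goals
          simp only [Quaternion.re_mul, Quaternion.imI_mul, Quaternion.imJ_mul,
            Quaternion.imK_mul, ha₀, ha₁, ha₂, ha₃, hb₀, hb₁, hb₂, hb₃]
          push_cast; linarith
      · have h : (a₀ : ℚ) + a₁ + a₂ + a₃ + (b₀ + b₁ + b₂ + b₃) = 2 * t + 1 := by
          exact_mod_cast ht
        refine Or.inl ⟨a₀ * b₀ - a₁ * b₁ - a₂ * b₂ - a₃ * b₃ + a₀ + b₀ - t - 1,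
          a₀ * b₁ + a₁ * b₀ + a₂ * b₃ - a₃ * b₂ + t + 1 - a₃ - b₂,
          a₀ * b₂ - a₁ * b₃ + a₂ * b₀ + a₃ * b₁ + t + 1 - a₁ - b₃,
          a₀ * b₃ + a₁ * b₂ - a₂ * b₁ + a₃ * b₀ + t + 1 - a₂ - b₁, ?_, ?_, ?_, ?_⟩
        all_goals
          simp only [Quaternion.re_mul, Quaternion.imI_mul, Quaternion.imJ_mul,
            Quaternion.imK_mul, ha₀, ha₁, ha₂, ha₃, hb₀, hb₁, hb₂, hb₃]
          push_cast; linarith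
  one_mem' := Or.inl ⟨1, 0, 0, 0,
    by simp [Quaternion.re_one], by simp [Quaternion.imI_one], by simp [Quaternion.imJ_one],
    by simp [Quaternion.imK_one]⟩
  add_mem' := by
    rintro _ _ (⟨a₀, a₁, a₂, a₃, ha₀, ha₁, ha₂, ha₃⟩ | ⟨a₀, a₁, a₂, a₃, ha₀, ha₁, ha₂, ha₃⟩)
      (⟨b₀, b₁, b₂, b₃, hb₀, hb₁, hb₂, hb₃⟩ | ⟨b₀, b₁, b₂, b₃, hb₀, hb₁, hb₂, hb₃⟩)
    · exact Or.inl ⟨a₀ + b₀, a₁ + b₁, a₂ + b₂, a₃ + b₃,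
        by rw [Quaternion.re_add, ha₀, hb₀]; push_cast; ring,
        by rw [Quaternion.imI_add, ha₁, hb₁]; push_cast; ring,
        by rw [Quaternion.imJ_add, ha₂, hb₂]; push_cast; ring,
        by rw [Quaternion.imK_add, ha₃, hb₃]; push_cast; ring⟩
    · exact Or.inr ⟨a₀ + b₀, a₁ + b₁, a₂ + b₂, a₃ + b₃,
        by rw [Quaternion.re_add, ha₀, hb₀]; push_cast; ring,
        by rw [Quaternion.imI_add, ha₁, hb₁]; push_cast; ring,
        by rw [Quaternion.imJ_add, ha₂, hb₂]; push_cast; ring,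
        by rw [Quaternion.imK_add, ha₃, hb₃]; push_cast; ring⟩
    · exact Or.inr ⟨a₀ + b₀, a₁ + b₁, a₂ + b₂, a₃ + b₃,
        by rw [Quaternion.re_add, ha₀, hb₀]; push_cast; ring,
        by rw [Quaternion.imI_add, ha₁, hb₁]; push_cast; ring,
        by rw [Quaternion.imJ_add, ha₂, hb₂]; push_cast; ring,
        by rw [Quaternion.imK_add, ha₃, hb₃]; push_cast; ring⟩
    · exact Or.inl ⟨a₀ + b₀ + 1, a₁ + b₁ + 1, a₂ + b₂ + 1, a₃ + b₃ + 1,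
        by rw [Quaternion.re_add, ha₀, hb₀]; push_cast; ring,
        by rw [Quaternion.imI_add, ha₁, hb₁]; push_cast; ring,
        by rw [Quaternion.imJ_add, ha₂, hb₂]; push_cast; ring,
        by rw [Quaternion.imK_add, ha₃, hb₃]; push_cast; ring⟩
  zero_mem' := Or.inl ⟨0, 0, 0, 0,
    by simp [Quaternion.re_zero], by simp [Quaternion.imI_zero], by simp [Quaternion.imJ_zero],
    by simp [Quaternion.imK_zero]⟩
  neg_mem' := by
    rintro _ (⟨a₀, a₁, a₂, a₃, ha₀, ha₁, ha₂, ha₃⟩ | ⟨a₀, a₁, a₂, a₃, ha₀, ha₁, ha₂, ha₃⟩)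
    · exact Or.inl ⟨-a₀, -a₁, -a₂, -a₃,
        by rw [Quaternion.re_neg, ha₀]; push_cast; ring,
        by rw [Quaternion.imI_neg, ha₁]; push_cast; ring,
        by rw [Quaternion.imJ_neg, ha₂]; push_cast; ring,
        by rw [Quaternion.imK_neg, ha₃]; push_cast; ring⟩
    · exact Or.inr ⟨-a₀ - 1, -a₁ - 1, -a₂ - 1, -a₃ - 1,
        by rw [Quaternion.re_neg, ha₀]; push_cast; ring,
        by rw [Quaternion.imI_neg, ha₁]; push_cast; ring,
        by rw [Quaternion.imJ_neg, ha₂]; push_cast; ring,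
        by rw [Quaternion.imK_neg, ha₃]; push_cast; ring⟩

/-- `Int(S, R) = {f ∈ 𝔻[x] | f(S) ⊆ R}`, where `𝔻` is the division ring of rational quaternions.
The indeterminate is central, and `Polynomial.eval` is right evaluation: the value of
`∑ aᵢ xⁱ` at `α` is `∑ aᵢ αⁱ`. -/
def intPoly (R : Subring (Quaternion ℚ)) (S : Set (Quaternion ℚ)) :
    Set (Polynomial (Quaternion ℚ)) :=
  {f | ∀ α ∈ S, f.eval α ∈ R}

/-- `S` is a ringset of `R` if `Int(S, R)` is a subring of `𝔻[x]`. -/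
def IsRingset (R : Subring (Quaternion ℚ)) (S : Set (Quaternion ℚ)) : Prop :=
  ∃ T : Subring (Polynomial (Quaternion ℚ)), (T : Set (Polynomial (Quaternion ℚ))) = intPoly R S

/-- The minimal polynomial class of `m ∈ ℤ[x]` in `R`: the elements of `R` whose minimal
polynomial over `ℚ` is `m`. -/
def minpolyClass (R : Subring (Quaternion ℚ)) (m : Polynomial ℤ) : Set (Quaternion ℚ) :=
  {α | α ∈ R ∧ minpoly ℚ α = m.map (Int.castRingHom ℚ)}

/-- `S` is reduced (with respect to `R`) if it lies in the minimal polynomial class of a monic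
quadratic integer polynomial, and no integer translate `S + a` is contained in `nR` with `n ≥ 2`. -/
def IsReduced (R : Subring (Quaternion ℚ)) (S : Set (Quaternion ℚ)) : Prop :=
  (∃ m : Polynomial ℤ, m.Monic ∧ m.natDegree = 2 ∧ S ⊆ minpolyClass R m) ∧
  ∀ a n : ℤ, 2 ≤ n →
    ¬ (fun α : Quaternion ℚ => α + (a : Quaternion ℚ)) '' S ⊆
      (fun γ : Quaternion ℚ => (n : Quaternion ℚ) * γ) '' (R : Set (Quaternion ℚ))

/-- The set `Δ(S)` of differences of elements of `S`. -/
def diffSet (S : Set (Quaternion ℚ)) : Set (Quaternion ℚ) :=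
  {δ | ∃ α ∈ S, ∃ β ∈ S, δ = α - β}

/-- `Γ(S)`: the greatest common divisor of the norms `N(δ)`, `δ ∈ Δ(S)` (these norms are integers
when `S` is a set of Lipschitz or Hurwitz quaternions), as the largest natural number `d` such that
every norm is an integer multiple of `d`. If `S` is a singleton the set of such `d` is unbounded
and the value is `0`. -/
noncomputable def normGcd (S : Set (Quaternion ℚ)) : ℕ :=
  sSup {d : ℕ | ∀ δ ∈ diffSet S, ∃ c : ℤ, Quaternion.normSq δ = (d : ℚ) * (c : ℚ)}

/-- Congruence modulo `4` in the ring of Lipschitz quaternions. -/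
def CongMod4 (α β : Quaternion ℚ) : Prop :=
  ∃ ε ∈ lipschitz, α - β = 4 * ε

/-- There are elements of `Δ(S)` that are congruent modulo `4` to distinct members of
`{2i + 2j, 2i + 2k, 2j + 2k}`. -/
def MeetsTwoResidues (S : Set (Quaternion ℚ)) : Prop :=
  ∃ ρ₁ ∈ ({2 * qi + 2 * qj, 2 * qi + 2 * qk, 2 * qj + 2 * qk} : Set (Quaternion ℚ)),
  ∃ ρ₂ ∈ ({2 * qi + 2 * qj, 2 * qi + 2 * qk, 2 * qj + 2 * qk} : Set (Quaternion ℚ)),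
    ρ₁ ≠ ρ₂ ∧ ∃ δ₁ ∈ diffSet S, ∃ δ₂ ∈ diffSet S, CongMod4 δ₁ ρ₁ ∧ CongMod4 δ₂ ρ₂

end QuatRingset

namespace QuatRingset

/-! All elements of S share a trace t and a norm n, so α² = tα − n on S and each polynomial f acts
on S as an affine map α ↦ aα + b. Then (fg)(α) = f(α)g(α) + a(g(α)α − αg(α)). Since f is integral on
S only if aΔ(S) ⊆ R, `isRingset_iff` turns the ringset property into: every a with aΔ(S) ⊆ R
satisfies a(γα − αγ) ∈ R for all γ ∈ R, α ∈ S. Moreover aδ·δ̄ = N(δ)a gives Γa ∈ R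
(`normGcd_mul_mem`).

An odd prime p dividing Γ makes the differences isotropic and pairwise orthogonal, hence parallel,
mod p. Then a = 1/p or a = v̄/p, with v a difference, breaks the criterion for a reduced set
(`not_odd_prime_dvd`). So Γ is a power of 2.

Hurwitz: if 4 ∣ Γ, then a = 1/2 breaks the criterion. If Γ = 2, both 2a and the commutators have
even norm, so their product has norm divisible by 4 and can be halved.

Lipschitz: Γ is even, and commutators lie in 2L, so 2a ∈ L suffices; this holds for Γ = 2 and 4. If
8 ∣ Γ, each difference is 2d with d of even coordinate sum. If all these d share an even coordinate,
belonging to the unit u, then a = (1 + u)/4 breaks the criterion. Otherwise two of the listed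
residues occur, which forces 16 ∤ Γ, and for Γ = 8 they impose enough parity on a and α. -/

open Polynomial

/-! ### The commutator criterion -/

/-- Every element of a minimal polynomial class of degree two has the same trace and norm. -/
theorem exists_trace_norm {R : Subring (Quaternion ℚ)} {S : Set (Quaternion ℚ)} {m : ℤ[X]}
    (hm : m.Monic) (hdeg : m.natDegree = 2) (hS : S ⊆ minpolyClass R m) :
    ∃ t n : ℤ, ∀ α ∈ S, 2 * α.re = t ∧ Quaternion.normSq α = n := by
  refine ⟨-m.coeff 1, m.coeff 0, fun α hα => ?_⟩
  have hmin := (hS hα).2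
  -- The reduced characteristic polynomial of α: a monic quadratic multiple of m, hence m itself, so
  -- trace and norm are read off the coefficients of m.
  set p : ℚ[X] := X ^ 2 + (C (-(2 * α.re)) * X + C (Quaternion.normSq α)) with hp
  have hlow : (C (-(2 * α.re)) * X + C (Quaternion.normSq α) : ℚ[X]).degree < 2 :=
    degree_linear_lt
  have hpm : p.Monic := monic_X_pow_add (n := 2) hlow
  have hpd : p.natDegree = 2 := by
    rw [hp]; compute_degree!
  have hroot : aeval α p = 0 := by
    simp only [hp, map_add, map_mul, map_pow, aeval_X, aeval_C]
    have hsq : α ^ 2 = ((2 * α.re : ℚ) : Quaternion ℚ) * α -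
        ((Quaternion.normSq α : ℚ) : Quaternion ℚ) := by
      ext <;> simp [pow_two, Quaternion.normSq_def'] <;> ring
    rw [hsq, eq_ratCast, eq_ratCast]
    push_cast
    noncomm_ring
  have hdvd : m.map (Int.castRingHom ℚ) ∣ p := hmin ▸ minpoly.dvd ℚ α hroot
  have heq : p = m.map (Int.castRingHom ℚ) :=
    eq_of_monic_of_dvd_of_natDegree_le (hm.map _) hpm hdvd
      (by rw [hpd, hm.natDegree_map, hdeg])
  constructor
  · have h1 := congrArg (fun q => q.coeff 1) heq
    simp [hp, coeff_C] at h1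
    push_cast
    linarith
  · have h0 := congrArg (fun q => q.coeff 0) heq
    simpa [hp] using h0

/-- Evaluation is not multiplicative: moving the central x past g leaves g(α) between each
coefficient of f and its power of α. -/
theorem eval_mul_eq_sum (f g : (Quaternion ℚ)[X]) (α : Quaternion ℚ) :
    (f * g).eval α = f.sum fun i c => c * g.eval α * α ^ i := by
  induction f using Polynomial.induction_on' with
  | add p q hp hq =>
    rw [add_mul, eval_add, hp, hq, sum_add_index] <;> intros <;> simp [add_mul]
  | monomial i c =>
    rw [sum_monomial_index _ _ (by simp), ← C_mul_X_pow_eq_monomial, mul_assoc, X_pow_mul,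
      ← mul_assoc, eval_mul_X_pow, eval_C_mul]

/-- Polynomial evaluation on elements of fixed trace and norm is affine linear, uniformly. -/
theorem exists_pow_eq {S : Set (Quaternion ℚ)} {t n : ℤ}
    (hS : ∀ α ∈ S, 2 * α.re = t ∧ Quaternion.normSq α = n) (k : ℕ) :
    ∃ u w : ℚ, ∀ α ∈ S, α ^ k = (u : Quaternion ℚ) * α + (w : Quaternion ℚ) := by
  induction k with
  | zero => exact ⟨0, 1, fun α _ => by simp⟩
  | succ k ih =>
    obtain ⟨u, w, h⟩ := ih
    -- From α² = tα − n: (uα + w)α = (ut + w)α − un.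
    refine ⟨u * t + w, -u * n, fun α hα => ?_⟩
    obtain ⟨h1, h2⟩ := hS α hα
    rw [pow_succ, h α hα, ← h1, ← h2]
    ext <;> simp [Quaternion.normSq_def'] <;> ring

/-- A commutator criterion for ringsets. -/
theorem isRingset_iff {R : Subring (Quaternion ℚ)} {S : Set (Quaternion ℚ)} {t n : ℤ}
    (hS : ∀ α ∈ S, 2 * α.re = t ∧ Quaternion.normSq α = n) :
    IsRingset R S ↔ ∀ a, (∀ δ ∈ diffSet S, a * δ ∈ R) →
      ∀ α ∈ S, ∀ γ ∈ R, a * (γ * α - α * γ) ∈ R := by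
  constructor
  · rintro ⟨T, hT⟩ a ha α hα γ hγ
    -- a(x − α) is integral on S because aΔ(S) ⊆ R. Its product with the constant γ takes the value
    -- a(γα − αγ) at α.
    have hf : C a * X - C (a * α) ∈ T := by
      rw [← SetLike.mem_coe, hT]
      intro β hβ
      simpa [mul_sub] using ha _ ⟨β, hβ, α, hα, rfl⟩
    have hg : C γ ∈ T := by
      rw [← SetLike.mem_coe, hT]
      intro β _
      simpa using hγ
    have hfg := T.mul_mem hf hg
    rw [← SetLike.mem_coe, hT] at hfg
    have := hfg α hα
    have e : (C a * X - C (a * α)) * C γ = C (a * γ) * X - C (a * α * γ) := by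
      rw [sub_mul, mul_assoc, X_mul_C, ← mul_assoc, C_mul, C_mul, C_mul, C_mul]
    rw [e] at this
    simpa [mul_sub, mul_assoc] using this
  · intro h
    choose u w huw using exists_pow_eq hS
    refine ⟨{
        carrier := intPoly R S
        mul_mem' := ?_, one_mem' := ?_, add_mem' := ?_, zero_mem' := ?_, neg_mem' := ?_ },
      rfl⟩
    · intro f g hf hg α hα
      set a := f.sum fun i c => c * (u i : Quaternion ℚ) with ha
      set b := f.sum fun i c => c * (w i : Quaternion ℚ) with hb
      have key : ∀ β ∈ S, ∀ γ, (f.sum fun i c => c * γ * β ^ i) = a * (γ * β) + b * γ := by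
        intro β hβ γ
        simp only [ha, hb, Polynomial.sum, Finset.sum_mul, ← Finset.sum_add_distrib]
        refine Finset.sum_congr rfl fun i _ => ?_
        rw [huw i β hβ, mul_add, mul_assoc, mul_assoc, mul_assoc, mul_assoc,
          ← mul_assoc γ, ← Rat.cast_comm, ← Rat.cast_comm (w i) γ, mul_assoc]
      have keyf : ∀ β ∈ S, f.eval β = a * β + b := by
        intro β hβ
        have := key β hβ 1
        rw [eval_eq_sum]
        simpa using this
      rw [eval_mul_eq_sum, key α hα]
      have h1 : a * (g.eval α * α - α * g.eval α) ∈ R := by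
        refine h a ?_ α hα _ (hg α hα)
        rintro _ ⟨x, hx, y, hy, rfl⟩
        have := R.sub_mem (hf x hx) (hf y hy)
        rw [keyf x hx, keyf y hy] at this
        simpa [mul_sub] using this
      -- With γ = g(α): aγα + bγ = a(γα − αγ) + (aα + b)γ.
      have h2 := R.add_mem h1 (R.mul_mem (hf α hα) (hg α hα))
      rw [keyf α hα] at h2
      convert h2 using 1
      noncomm_ring
    · intro α _
      simp
    · intro f g hf hg α hα
      simpa using R.add_mem (hf α hα) (hg α hα)
    · intro α _
      simp
    · intro f hf α hα
      simpa using R.neg_mem (hf α hα)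

/-! ### Γ as a genuine gcd, and denominators of multipliers -/

/-- The norm of one nonzero difference bounds every common divisor, so the supremum is attained. -/
theorem normGcd_mem {S : Set (Quaternion ℚ)} (hS : S.Nontrivial)
    (hint : ∀ δ ∈ diffSet S, ∃ c : ℤ, Quaternion.normSq δ = c) :
    BddAbove {d : ℕ | ∀ δ ∈ diffSet S, ∃ c : ℤ, Quaternion.normSq δ = (d : ℚ) * (c : ℚ)} ∧
      normGcd S ∈
        {d : ℕ | ∀ δ ∈ diffSet S, ∃ c : ℤ, Quaternion.normSq δ = (d : ℚ) * (c : ℚ)} := by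
  obtain ⟨x, hx, y, hy, hxy⟩ := hS
  have hmem : x - y ∈ diffSet S := ⟨x, hx, y, hy, rfl⟩
  obtain ⟨N, hN⟩ := hint _ hmem
  have hN0 : N ≠ 0 := by
    rintro rfl
    rw [Int.cast_zero, Quaternion.normSq_eq_zero, sub_eq_zero] at hN
    exact hxy hN
  have hb : BddAbove
      {d : ℕ | ∀ δ ∈ diffSet S, ∃ c : ℤ, Quaternion.normSq δ = (d : ℚ) * (c : ℚ)} := by
    refine ⟨N.natAbs, fun d hd => ?_⟩
    obtain ⟨c, hc⟩ := hd _ hmem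
    rw [hN] at hc
    have hc' : N = d * c := by exact_mod_cast hc
    exact Nat.le_of_dvd (Int.natAbs_pos.2 hN0) (Int.natCast_dvd.1 ⟨c, hc'⟩)
  refine ⟨hb, Nat.sSup_mem ⟨1, fun δ hδ => ?_⟩ hb⟩
  obtain ⟨c, hc⟩ := hint δ hδ
  exact ⟨c, by simpa using hc⟩

theorem normGcd_ne_zero {S : Set (Quaternion ℚ)} (hS : S.Nontrivial)
    (hint : ∀ δ ∈ diffSet S, ∃ c : ℤ, Quaternion.normSq δ = c) : normGcd S ≠ 0 := by
  have h := (normGcd_mem hS hint).1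
  have : 1 ≤ normGcd S := le_csSup h fun δ hδ => by
    obtain ⟨c, hc⟩ := hint δ hδ
    exact ⟨c, by simpa using hc⟩
  omega

/-- Upgrades "largest" to "greatest in divisibility": if d divides all norms, so does lcm(d, Γ),
which maximality forces to equal Γ. -/
theorem dvd_normGcd_iff {S : Set (Quaternion ℚ)} (hS : S.Nontrivial)
    (hint : ∀ δ ∈ diffSet S, ∃ c : ℤ, Quaternion.normSq δ = c) (d : ℕ) :
    d ∣ normGcd S ↔ ∀ δ ∈ diffSet S, ∃ c : ℤ, Quaternion.normSq δ = (d : ℚ) * (c : ℚ) := by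
  obtain ⟨hb, hmem⟩ := normGcd_mem hS hint
  constructor
  · rintro ⟨e, he⟩ δ hδ
    obtain ⟨c, hc⟩ := hmem δ hδ
    exact ⟨e * c, by rw [hc, he]; push_cast; ring⟩
  · intro hd
    have hl : Nat.lcm d (normGcd S) ≤ normGcd S := by
      refine le_csSup hb fun δ hδ => ?_
      obtain ⟨c, hc⟩ := hd δ hδ
      obtain ⟨c', hc'⟩ := hmem δ hδ
      obtain ⟨N, hN⟩ := hint δ hδ
      have h1 : (d : ℤ) ∣ N := ⟨c, by rw [hN] at hc; exact_mod_cast hc⟩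
      have h2 : (normGcd S : ℤ) ∣ N := ⟨c', by rw [hN] at hc'; exact_mod_cast hc'⟩
      obtain ⟨e, he⟩ : ((Nat.lcm d (normGcd S) : ℕ) : ℤ) ∣ N :=
        Int.natCast_dvd.2 (Nat.lcm_dvd (Int.natCast_dvd.1 h1) (Int.natCast_dvd.1 h2))
      exact ⟨e, by rw [hN, he]; push_cast; ring⟩
    have h0 := normGcd_ne_zero hS hint
    have : Nat.lcm d (normGcd S) = normGcd S :=
      le_antisymm hl (Nat.le_of_dvd (Nat.pos_of_ne_zero fun h => by
        rcases Nat.lcm_eq_zero_iff.1 h with h | h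
        · subst h
          obtain ⟨x, hx, y, hy, hxy⟩ := hS
          obtain ⟨c, hc⟩ := hd _ ⟨x, hx, y, hy, rfl⟩
          simp [sub_eq_zero] at hc
          exact hxy hc
        · exact h0 h) (Nat.dvd_lcm_right _ _))
    exact this ▸ Nat.dvd_lcm_left _ _

/-- The norm gcd multiplies every left multiplier of the difference set into the ring. -/
theorem normGcd_mul_mem {R : Subring (Quaternion ℚ)} {S : Set (Quaternion ℚ)} (hS : S.Nontrivial)
    (hint : ∀ δ ∈ diffSet S, ∃ c : ℤ, Quaternion.normSq δ = c)
    (hstar : ∀ δ ∈ diffSet S, star δ ∈ R) {a : Quaternion ℚ}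
    (ha : ∀ δ ∈ diffSet S, a * δ ∈ R) : ((normGcd S : ℚ) : Quaternion ℚ) * a ∈ R := by
  -- The integers z with za ∈ R form a subgroup gℤ. It contains every N(δ), as aδ·δ̄ = N(δ)a, so g ∣
  -- Γ.
  let I : AddSubgroup ℤ := R.toAddSubgroup.comap (zmultiplesHom (Quaternion ℚ) a)
  have hI : ∀ z : ℤ, z ∈ I ↔ z • a ∈ R := fun z => Iff.rfl
  obtain ⟨g, hg⟩ := Int.subgroup_cyclic I
  have hdvd : g.natAbs ∣ normGcd S := by
    rw [dvd_normGcd_iff hS hint]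
    intro δ hδ
    obtain ⟨N, hN⟩ := hint δ hδ
    have hNI : N ∈ I := by
      rw [hI, zsmul_eq_mul, Int.cast_comm]
      have h1 := R.mul_mem (ha δ hδ) (hstar δ hδ)
      rw [mul_assoc, Quaternion.self_mul_star, hN] at h1
      convert h1 using 2
      ext <;> simp
    rw [hg, AddSubgroup.mem_closure_singleton] at hNI
    obtain ⟨z, hz⟩ := hNI
    have : (g.natAbs : ℤ) ∣ N := Int.natAbs_dvd.2 ⟨z, by rw [← hz, smul_eq_mul]; ring⟩
    obtain ⟨c, hc⟩ := this
    exact ⟨c, by rw [hN, ← Int.cast_natCast (R := ℚ)]; exact_mod_cast congrArg (Int.cast (R := ℚ)) hc⟩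
  have hGI : (normGcd S : ℤ) ∈ I := by
    rw [hg, AddSubgroup.mem_closure_singleton]
    obtain ⟨z, hz⟩ := Int.natAbs_dvd.1 (Int.natCast_dvd_natCast.2 hdvd)
    exact ⟨z, by rw [hz, smul_eq_mul]; ring⟩
  rw [hI] at hGI
  simpa using hGI

/-! ### Coordinates and integrality -/

/-- The rational quaternion with given coordinates. -/
def quat (a b c d : ℚ) : Quaternion ℚ := ⟨a, b, c, d⟩

@[simp] theorem re_quat (a b c d : ℚ) : (quat a b c d).re = a := rfl
@[simp] theorem imI_quat (a b c d : ℚ) : (quat a b c d).imI = b := rfl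
@[simp] theorem imJ_quat (a b c d : ℚ) : (quat a b c d).imJ = c := rfl
@[simp] theorem imK_quat (a b c d : ℚ) : (quat a b c d).imK = d := rfl
@[simp] theorem re_qi : qi.re = 0 := rfl
@[simp] theorem imI_qi : qi.imI = 1 := rfl
@[simp] theorem imJ_qi : qi.imJ = 0 := rfl
@[simp] theorem imK_qi : qi.imK = 0 := rfl
@[simp] theorem re_qj : qj.re = 0 := rfl
@[simp] theorem imI_qj : qj.imI = 0 := rfl
@[simp] theorem imJ_qj : qj.imJ = 1 := rfl
@[simp] theorem imK_qj : qj.imK = 0 := rfl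
@[simp] theorem re_qk : qk.re = 0 := rfl
@[simp] theorem imI_qk : qk.imI = 0 := rfl
@[simp] theorem imJ_qk : qk.imJ = 0 := rfl
@[simp] theorem imK_qk : qk.imK = 1 := rfl

theorem quat_ext {x y : Quaternion ℚ} (h₀ : x.re = y.re) (h₁ : x.imI = y.imI)
    (h₂ : x.imJ = y.imJ) (h₃ : x.imK = y.imK) : x = y := by
  ext <;> assumption

theorem intCast_eq_quat (n : ℤ) : (n : Quaternion ℚ) = quat n 0 0 0 := by
  refine quat_ext ?_ ?_ ?_ ?_ <;> simp

theorem mem_lipschitz_iff {α : Quaternion ℚ} :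
    α ∈ lipschitz ↔ ∃ a₀ a₁ a₂ a₃ : ℤ, α = quat a₀ a₁ a₂ a₃ := by
  constructor
  · rintro ⟨a₀, a₁, a₂, a₃, h₀, h₁, h₂, h₃⟩
    exact ⟨a₀, a₁, a₂, a₃, quat_ext h₀ h₁ h₂ h₃⟩
  · rintro ⟨a₀, a₁, a₂, a₃, rfl⟩
    exact ⟨a₀, a₁, a₂, a₃, rfl, rfl, rfl, rfl⟩

/-- Hurwitz quaternions in terms of doubled coordinates. -/
theorem mem_hurwitz_iff {α : Quaternion ℚ} :
    α ∈ hurwitz ↔ ∃ a₀ a₁ a₂ a₃ : ℤ, 2 ∣ a₀ - a₁ ∧ 2 ∣ a₀ - a₂ ∧ 2 ∣ a₀ - a₃ ∧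
      α = quat (a₀ / 2) (a₁ / 2) (a₂ / 2) (a₃ / 2) := by
  constructor
  · rintro (⟨a₀, a₁, a₂, a₃, h₀, h₁, h₂, h₃⟩ | ⟨a₀, a₁, a₂, a₃, h₀, h₁, h₂, h₃⟩)
    · refine ⟨2 * a₀, 2 * a₁, 2 * a₂, 2 * a₃, by omega, by omega, by omega, ?_⟩
      refine quat_ext ?_ ?_ ?_ ?_ <;> simp [*]
    · refine ⟨2 * a₀ + 1, 2 * a₁ + 1, 2 * a₂ + 1, 2 * a₃ + 1, by omega, by omega, by omega, ?_⟩
      refine quat_ext ?_ ?_ ?_ ?_ <;> simp [*] <;> ring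
  · rintro ⟨a₀, a₁, a₂, a₃, h₁, h₂, h₃, rfl⟩
    obtain ⟨b₀, hb | hb⟩ := Int.even_or_odd' a₀
    · obtain ⟨b₁, h₁⟩ := h₁
      obtain ⟨b₂, h₂⟩ := h₂
      obtain ⟨b₃, h₃⟩ := h₃
      obtain rfl : a₁ = 2 * (b₀ - b₁) := by omega
      obtain rfl : a₂ = 2 * (b₀ - b₂) := by omega
      obtain rfl : a₃ = 2 * (b₀ - b₃) := by omega
      subst hb
      refine Or.inl ⟨b₀, b₀ - b₁, b₀ - b₂, b₀ - b₃, ?_, ?_, ?_, ?_⟩ <;> simp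
    · obtain ⟨b₁, h₁⟩ := h₁
      obtain ⟨b₂, h₂⟩ := h₂
      obtain ⟨b₃, h₃⟩ := h₃
      obtain rfl : a₁ = 2 * (b₀ - b₁) + 1 := by omega
      obtain rfl : a₂ = 2 * (b₀ - b₂) + 1 := by omega
      obtain rfl : a₃ = 2 * (b₀ - b₃) + 1 := by omega
      subst hb
      refine Or.inr ⟨b₀, b₀ - b₁, b₀ - b₂, b₀ - b₃, ?_, ?_, ?_, ?_⟩ <;> simp <;> ring

theorem lipschitz_le_hurwitz : lipschitz ≤ hurwitz := fun _ h => Or.inl h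

/-- Pure Hurwitz quaternions have integral coordinates. -/
theorem exists_int_of_mem_hurwitz {δ : Quaternion ℚ} (h : δ ∈ hurwitz) (h0 : δ.re = 0) :
    ∃ v₁ v₂ v₃ : ℤ, δ = quat 0 v₁ v₂ v₃ := by
  rcases h with ⟨a₀, a₁, a₂, a₃, h₀, h₁, h₂, h₃⟩ | ⟨a₀, a₁, a₂, a₃, h₀, h₁, h₂, h₃⟩
  · exact ⟨a₁, a₂, a₃, quat_ext h0 h₁ h₂ h₃⟩
  · exfalso
    have h : ((2 * a₀ + 1 : ℤ) : ℚ) = 0 := by push_cast; linarith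
    have : (2 * a₀ + 1 : ℤ) = 0 := by exact_mod_cast h
    omega

/-- Equal traces make differences pure, which excludes half-integral coordinates even in H. -/
theorem exists_int_of_mem_diffSet {R : Subring (Quaternion ℚ)} (hH : R ≤ hurwitz)
    {S : Set (Quaternion ℚ)} {t : ℤ} (hSR : S ⊆ R) (hS : ∀ α ∈ S, 2 * α.re = t)
    {δ : Quaternion ℚ} (hδ : δ ∈ diffSet S) : ∃ v₁ v₂ v₃ : ℤ, δ = quat 0 v₁ v₂ v₃ := by
  obtain ⟨x, hx, y, hy, rfl⟩ := hδ
  refine exists_int_of_mem_hurwitz (hH (R.sub_mem (hSR hx) (hSR hy))) ?_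
  have h1 := hS x hx
  have h2 := hS y hy
  rw [Quaternion.re_sub]
  linarith

theorem normSq_mk (a b c d : ℚ) :
    Quaternion.normSq (quat a b c d) = a ^ 2 + b ^ 2 + c ^ 2 + d ^ 2 := by
  simp [Quaternion.normSq_def']

/-! ### Odd primes do not divide Γ -/

/-- In a reduced set, the imaginary parts do not all vanish modulo an odd number. -/
theorem exists_not_dvd_of_reduced {R : Subring (Quaternion ℚ)} (hL : lipschitz ≤ R)
    (hH : R ≤ hurwitz) {S : Set (Quaternion ℚ)} {t : ℤ} (hSR : S ⊆ R)
    (hS : ∀ α ∈ S, 2 * α.re = t)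
    (hred : ∀ a n : ℤ, 2 ≤ n → ¬ (fun α : Quaternion ℚ => α + (a : Quaternion ℚ)) '' S ⊆
      (fun γ : Quaternion ℚ => (n : Quaternion ℚ) * γ) '' (R : Set (Quaternion ℚ)))
    {p : ℤ} (hp : 2 ≤ p) (hp2 : Odd p) :
    ∃ a₁ a₂ a₃ : ℤ, quat (t / 2) (a₁ / 2) (a₂ / 2) (a₃ / 2) ∈ S ∧
      ¬ (p ∣ a₁ ∧ p ∣ a₂ ∧ p ∣ a₃) := by
  by_contra! hcon
  obtain ⟨k, rfl⟩ := hp2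
  -- With p = 2k + 1, translating by kt turns the real part t/2 into p·t/2.
  refine hred (k * t) _ hp ?_
  rintro _ ⟨α, hα, rfl⟩
  obtain ⟨a₀, a₁, a₂, a₃, -, -, -, rfl⟩ := mem_hurwitz_iff.1 (hH (hSR hα))
  obtain rfl : a₀ = t := by
    have := hS _ hα
    rw [re_quat] at this
    have : (a₀ : ℚ) = t := by linarith
    exact_mod_cast this
  obtain ⟨⟨b₁, rfl⟩, ⟨b₂, rfl⟩, ⟨b₃, rfl⟩⟩ := hcon _ _ _ hα
  refine ⟨quat (a₀ / 2) (b₁ / 2) (b₂ / 2) (b₃ / 2), ?_, ?_⟩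
  -- The quotient by p differs from α + kt by the Lipschitz quaternion k(t + b₁i + b₂j + b₃k), so it
  -- lies in R.
  · have h1 := R.sub_mem (R.add_mem (hSR hα) (intCast_mem R (k * a₀)))
      (hL (mem_lipschitz_iff.2 ⟨k * a₀, k * b₁, k * b₂, k * b₃, rfl⟩))
    rw [SetLike.mem_coe]
    convert h1 using 1
    refine quat_ext ?_ ?_ ?_ ?_ <;> simp <;> ring
  · simp only [intCast_eq_quat]
    refine quat_ext ?_ ?_ ?_ ?_ <;> simp <;> ring

/-- Lagrange's identity: (v₂w₃ − v₃w₂)² = (v₂² + v₃²)(w₂² + w₃²) − (v₂w₂ + v₃w₃)² ≡ v₁²w₁² − (v₁w₁)²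
= 0 mod p. Cyclic permutation then kills the whole cross product. -/
theorem dvd_of_isotropic {p : ℤ} (hp : Prime p) {v₁ v₂ v₃ w₁ w₂ w₃ : ℤ}
    (hv : p ∣ v₁ ^ 2 + v₂ ^ 2 + v₃ ^ 2) (hw : p ∣ w₁ ^ 2 + w₂ ^ 2 + w₃ ^ 2)
    (hvw : p ∣ v₁ * w₁ + v₂ * w₂ + v₃ * w₃) : p ∣ v₂ * w₃ - v₃ * w₂ := by
  obtain ⟨a, ha⟩ := hv
  obtain ⟨b, hb⟩ := hw
  obtain ⟨c, hc⟩ := hvw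
  refine hp.dvd_of_dvd_pow (n := 2) ⟨a * (w₁ ^ 2 + w₂ ^ 2 + w₃ ^ 2) -
    c * (v₁ * w₁ + v₂ * w₂ + v₃ * w₃) - a * w₁ ^ 2 - b * v₁ ^ 2 + 2 * c * v₁ * w₁, ?_⟩
  linear_combination (w₁ ^ 2 + w₂ ^ 2 + w₃ ^ 2 - w₁ ^ 2) * ha - v₁ ^ 2 * hb +
    (2 * v₁ * w₁ - (v₁ * w₁ + v₂ * w₂ + v₃ * w₃)) * hc

/-- If `x / p` is Hurwitz for an integral quaternion `x` and an odd prime `p`, then `p`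
divides `x`. -/
theorem dvd_of_mem_hurwitz {p : ℤ} (hp : Prime p) (hp2 : ¬ p ∣ 2) {x₀ x₁ x₂ x₃ : ℤ}
    (h : quat (x₀ / p) (x₁ / p) (x₂ / p) (x₃ / p) ∈ hurwitz) :
    p ∣ x₀ ∧ p ∣ x₁ ∧ p ∣ x₂ ∧ p ∣ x₃ := by
  have hp0 : (p : ℚ) ≠ 0 := by exact_mod_cast hp.ne_zero
  obtain ⟨a₀, a₁, a₂, a₃, -, -, -, h⟩ := mem_hurwitz_iff.1 h
  have key : ∀ x a : ℤ, (x / p : ℚ) = a / 2 → p ∣ x := by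
    intro x a hxa
    rw [div_eq_div_iff hp0 two_ne_zero] at hxa
    have : x * 2 = a * p := by exact_mod_cast hxa
    exact (hp.dvd_or_dvd ⟨a, by rw [this, mul_comm]⟩).resolve_right hp2
  exact ⟨key _ _ (congrArg (·.re) h), key _ _ (congrArg (·.imI) h), key _ _ (congrArg (·.imJ) h),
    key _ _ (congrArg (·.imK) h)⟩

/-- If the commutator criterion holds for a reduced set, then no odd prime divides all the norms
of differences. -/
theorem not_odd_prime_dvd {R : Subring (Quaternion ℚ)} (hL : lipschitz ≤ R)
    (hH : R ≤ hurwitz) {S : Set (Quaternion ℚ)} {t : ℤ} (hSR : S ⊆ R)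
    (hS : ∀ α ∈ S, 2 * α.re = t)
    (hred : ∀ a n : ℤ, 2 ≤ n → ¬ (fun α : Quaternion ℚ => α + (a : Quaternion ℚ)) '' S ⊆
      (fun γ : Quaternion ℚ => (n : Quaternion ℚ) * γ) '' (R : Set (Quaternion ℚ)))
    (hcomm : ∀ a, (∀ δ ∈ diffSet S, a * δ ∈ R) → ∀ α ∈ S, ∀ γ ∈ R, a * (γ * α - α * γ) ∈ R)
    {p : ℕ} (hp : p.Prime) (hp2 : p ≠ 2)
    (hdvd : ∀ δ ∈ diffSet S, ∃ c : ℤ, Quaternion.normSq δ = (p : ℚ) * (c : ℚ)) : False := by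
  have hpZ : Prime (p : ℤ) := Nat.prime_iff_prime_int.1 hp
  have hpo : Odd (p : ℤ) := by exact_mod_cast hp.odd_of_ne_two hp2
  have hp0 : (p : ℚ) ≠ 0 := by exact_mod_cast hp.ne_zero
  have hp2' : ¬ (p : ℤ) ∣ 2 := fun h => by
    have : p ∣ 2 := by exact_mod_cast h
    exact hp2 ((Nat.prime_dvd_prime_iff_eq hp Nat.prime_two).1 this)
  have hi : qi ∈ R := hL ⟨0, 1, 0, 0, by simp [qi]⟩
  have hj : qj ∈ R := hL ⟨0, 0, 1, 0, by simp [qj]⟩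
  have hk : qk ∈ R := hL ⟨0, 0, 0, 1, by simp [qk]⟩
  obtain ⟨a₁, a₂, a₃, hα, hnd⟩ :=
    exists_not_dvd_of_reduced hL hH hSR hS hred (by exact_mod_cast hp.two_le) hpo
  -- If p divides every difference in R, the multiplier 1/p is admissible, and commutators with i
  -- and j expose the imaginary coordinates of α.
  by_cases hall : ∀ δ ∈ diffSet S, quat (p : ℚ)⁻¹ 0 0 0 * δ ∈ R
  · have h := hcomm _ hall _ hα
    have h1 := hH (h _ hi)
    have h2 := hH (h _ hj)
    have e1 : quat (p : ℚ)⁻¹ 0 0 0 * (qi * quat (t / 2) (a₁ / 2) (a₂ / 2) (a₃ / 2) -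
        quat (t / 2) (a₁ / 2) (a₂ / 2) (a₃ / 2) * qi) =
          quat ((0 : ℤ) / (p : ℤ)) ((0 : ℤ) / (p : ℤ)) ((-a₃ : ℤ) / (p : ℤ))
            ((a₂ : ℤ) / (p : ℤ)) := by
      refine quat_ext ?_ ?_ ?_ ?_ <;> simp <;> field_simp <;> ring
    have e2 : quat (p : ℚ)⁻¹ 0 0 0 * (qj * quat (t / 2) (a₁ / 2) (a₂ / 2) (a₃ / 2) -
        quat (t / 2) (a₁ / 2) (a₂ / 2) (a₃ / 2) * qj) =
          quat ((0 : ℤ) / (p : ℤ)) ((a₃ : ℤ) / (p : ℤ)) ((0 : ℤ) / (p : ℤ))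
            ((-a₁ : ℤ) / (p : ℤ)) := by
      refine quat_ext ?_ ?_ ?_ ?_ <;> simp <;> field_simp <;> ring
    rw [e1] at h1
    rw [e2] at h2
    obtain ⟨-, -, h3, h4⟩ := dvd_of_mem_hurwitz hpZ hp2' h1
    obtain ⟨-, -, -, h5⟩ := dvd_of_mem_hurwitz hpZ hp2' h2
    exact hnd ⟨(dvd_neg.1 h5), h4, dvd_neg.1 h3⟩
  · push Not at hall
    obtain ⟨_, ⟨x, hx, y, hy, rfl⟩, hxy⟩ := hall
    obtain ⟨v₁, v₂, v₃, hv⟩ := exists_int_of_mem_diffSet hH hSR hS ⟨x, hx, y, hy, rfl⟩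
    have hvnd : ¬ ((p : ℤ) ∣ v₁ ∧ (p : ℤ) ∣ v₂ ∧ (p : ℤ) ∣ v₃) := by
      rintro ⟨⟨b₁, rfl⟩, ⟨b₂, rfl⟩, ⟨b₃, rfl⟩⟩
      refine hxy (hL (mem_lipschitz_iff.2 ⟨0, b₁, b₂, b₃, ?_⟩))
      rw [hv]
      refine quat_ext ?_ ?_ ?_ ?_ <;> simp <;> field_simp
    have hnorm : ∀ δ ∈ diffSet S, ∀ w₁ w₂ w₃ : ℤ, δ = quat 0 w₁ w₂ w₃ →
        (p : ℤ) ∣ w₁ ^ 2 + w₂ ^ 2 + w₃ ^ 2 := by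
      rintro δ hδ w₁ w₂ w₃ rfl
      obtain ⟨c, hc⟩ := hdvd _ hδ
      rw [normSq_mk] at hc
      exact ⟨c, by simpa using (by exact_mod_cast hc :
        0 ^ 2 + w₁ ^ 2 + w₂ ^ 2 + w₃ ^ 2 = (p : ℤ) * c)⟩
    have hvv := hnorm _ ⟨x, hx, y, hy, rfl⟩ _ _ _ hv
    -- a = v̄/p for a difference v not divisible by p. It is admissible since v̄w = v·w − v×w, and
    -- both terms vanish mod p.
    set a : Quaternion ℚ := quat 0 (-v₁ / p) (-v₂ / p) (-v₃ / p) with ha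
    have hbase : ∀ z ∈ S, a * (z - y) ∈ R := by
      intro z hz
      obtain ⟨w₁, w₂, w₃, hw⟩ := exists_int_of_mem_diffSet hH hSR hS ⟨z, hz, y, hy, rfl⟩
      have hww := hnorm _ ⟨z, hz, y, hy, rfl⟩ _ _ _ hw
      have hvw := hnorm _ ⟨x, hx, z, hz, rfl⟩ (v₁ - w₁) (v₂ - w₂) (v₃ - w₃) (by
        rw [← sub_sub_sub_cancel_right x z y, hv, hw]
        refine quat_ext ?_ ?_ ?_ ?_ <;> simp)
      -- Polarization of N(v), N(w) and N(v − w), with p odd.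
      have hdot : (p : ℤ) ∣ v₁ * w₁ + v₂ * w₂ + v₃ * w₃ := by
        refine (hpZ.dvd_or_dvd (?_ : (p : ℤ) ∣ 2 * _)).resolve_left hp2'
        have := dvd_sub (dvd_add hvv hww) hvw
        ring_nf at this ⊢
        exact this
      obtain ⟨c₀, h₀⟩ := hdot
      obtain ⟨c₁, h₁⟩ := dvd_of_isotropic hpZ hvv hww ⟨c₀, h₀⟩
      obtain ⟨c₂, h₂⟩ := dvd_of_isotropic (v₁ := v₂) (v₂ := v₃) (v₃ := v₁) (w₁ := w₂) (w₂ := w₃)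
        (w₃ := w₁) hpZ (by rwa [← add_rotate])
        (by rwa [← add_rotate])
        ⟨c₀, by rw [← h₀]; ring⟩
      obtain ⟨c₃, h₃⟩ := dvd_of_isotropic (v₁ := v₃) (v₂ := v₁) (v₃ := v₂) (w₁ := w₃) (w₂ := w₁)
        (w₃ := w₂) hpZ (by rwa [add_rotate])
        (by rwa [add_rotate])
        ⟨c₀, by rw [← h₀]; ring⟩
      refine hL (mem_lipschitz_iff.2 ⟨c₀, -c₁, -c₂, -c₃, ?_⟩)
      have h₀' : (v₁ * w₁ + v₂ * w₂ + v₃ * w₃ : ℚ) = p * c₀ := by exact_mod_cast h₀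
      have h₁' : (v₂ * w₃ - v₃ * w₂ : ℚ) = p * c₁ := by exact_mod_cast h₁
      have h₂' : (v₃ * w₁ - v₁ * w₃ : ℚ) = p * c₂ := by exact_mod_cast h₂
      have h₃' : (v₁ * w₂ - v₂ * w₁ : ℚ) = p * c₃ := by exact_mod_cast h₃
      rw [hw, ha]
      refine quat_ext ?_ ?_ ?_ ?_ <;> simp <;> field_simp
      · linarith
      · linarith
      · linarith
      · linarith
    have haΔ : ∀ δ ∈ diffSet S, a * δ ∈ R := by
      rintro _ ⟨z, hz, z', hz', rfl⟩
      have := R.sub_mem (hbase z hz) (hbase z' hz')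
      rwa [← mul_sub, sub_sub_sub_cancel_right] at this
    have h := hcomm _ haΔ _ hα
    have h1 := hH (h _ hi)
    have h2 := hH (h _ hj)
    have h3 := hH (h _ hk)
    have e1 : a * (qi * quat (t / 2) (a₁ / 2) (a₂ / 2) (a₃ / 2) -
        quat (t / 2) (a₁ / 2) (a₂ / 2) (a₃ / 2) * qi) =
          quat ((v₃ * a₂ - v₂ * a₃ : ℤ) / (p : ℤ)) ((-(v₂ * a₂ + v₃ * a₃) : ℤ) / (p : ℤ))
            ((v₁ * a₂ : ℤ) / (p : ℤ)) ((v₁ * a₃ : ℤ) / (p : ℤ)) := by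
      refine quat_ext ?_ ?_ ?_ ?_ <;> simp [ha] <;> field_simp <;> ring
    have e2 : a * (qj * quat (t / 2) (a₁ / 2) (a₂ / 2) (a₃ / 2) -
        quat (t / 2) (a₁ / 2) (a₂ / 2) (a₃ / 2) * qj) =
          quat ((v₁ * a₃ - v₃ * a₁ : ℤ) / (p : ℤ)) ((v₂ * a₁ : ℤ) / (p : ℤ))
            ((-(v₁ * a₁ + v₃ * a₃) : ℤ) / (p : ℤ)) ((v₂ * a₃ : ℤ) / (p : ℤ)) := by
      refine quat_ext ?_ ?_ ?_ ?_ <;> simp [ha] <;> field_simp <;> ring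
    have e3 : a * (qk * quat (t / 2) (a₁ / 2) (a₂ / 2) (a₃ / 2) -
        quat (t / 2) (a₁ / 2) (a₂ / 2) (a₃ / 2) * qk) =
          quat ((v₂ * a₁ - v₁ * a₂ : ℤ) / (p : ℤ)) ((v₃ * a₁ : ℤ) / (p : ℤ))
            ((v₃ * a₂ : ℤ) / (p : ℤ)) ((-(v₁ * a₁ + v₂ * a₂) : ℤ) / (p : ℤ)) := by
      refine quat_ext ?_ ?_ ?_ ?_ <;> simp [ha] <;> field_simp <;> ring
    rw [e1] at h1
    rw [e2] at h2
    rw [e3] at h3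
    obtain ⟨-, d1, h12, h13⟩ := dvd_of_mem_hurwitz hpZ hp2' h1
    obtain ⟨-, h21, d2, h23⟩ := dvd_of_mem_hurwitz hpZ hp2' h2
    obtain ⟨-, h31, h32, d3⟩ := dvd_of_mem_hurwitz hpZ hp2' h3
    rw [dvd_neg] at d1 d2 d3
    -- Mod p, all vᵣaₛ with r ≠ s and all pairwise sums of the vᵣaᵣ vanish. Where vᵣ ≢ 0, the
    -- products kill the other two aₛ and a sum kills aᵣ.
    have res : ∀ {u b : ℤ}, (p : ℤ) ∣ u * b → ¬ (p : ℤ) ∣ u → (p : ℤ) ∣ b :=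
      fun h hu => (hpZ.dvd_or_dvd h).resolve_left hu
    by_cases hv1 : (p : ℤ) ∣ v₁
    · by_cases hv2 : (p : ℤ) ∣ v₂
      · have hv3 : ¬ (p : ℤ) ∣ v₃ := fun h => hvnd ⟨hv1, hv2, h⟩
        exact hnd ⟨res h31 hv3, res h32 hv3,
          res ((dvd_add_right (hv1.mul_right _)).1 d2) hv3⟩
      · exact hnd ⟨res h21 hv2, res ((dvd_add_right (hv1.mul_right _)).1 d3) hv2, res h23 hv2⟩
    · have h2' := res h12 hv1
      exact hnd ⟨res ((dvd_add_left (h2'.mul_left _)).1 d3) hv1, h2', res h13 hv1⟩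

/-! ### Quaternion arithmetic and parity -/

theorem quat_mul (a₀ a₁ a₂ a₃ b₀ b₁ b₂ b₃ : ℚ) : quat a₀ a₁ a₂ a₃ * quat b₀ b₁ b₂ b₃ =
    quat (a₀ * b₀ - a₁ * b₁ - a₂ * b₂ - a₃ * b₃) (a₀ * b₁ + a₁ * b₀ + a₂ * b₃ - a₃ * b₂)
      (a₀ * b₂ - a₁ * b₃ + a₂ * b₀ + a₃ * b₁) (a₀ * b₃ + a₁ * b₂ - a₂ * b₁ + a₃ * b₀) := by
  refine quat_ext ?_ ?_ ?_ ?_ <;> simp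

theorem quat_sub (a₀ a₁ a₂ a₃ b₀ b₁ b₂ b₃ : ℚ) : quat a₀ a₁ a₂ a₃ - quat b₀ b₁ b₂ b₃ =
    quat (a₀ - b₀) (a₁ - b₁) (a₂ - b₂) (a₃ - b₃) := by
  refine quat_ext ?_ ?_ ?_ ?_ <;> simp

theorem quat_add (a₀ a₁ a₂ a₃ b₀ b₁ b₂ b₃ : ℚ) : quat a₀ a₁ a₂ a₃ + quat b₀ b₁ b₂ b₃ =
    quat (a₀ + b₀) (a₁ + b₁) (a₂ + b₂) (a₃ + b₃) := by
  refine quat_ext ?_ ?_ ?_ ?_ <;> simp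

theorem quat_inj {a₀ a₁ a₂ a₃ b₀ b₁ b₂ b₃ : ℚ} : quat a₀ a₁ a₂ a₃ = quat b₀ b₁ b₂ b₃ ↔
    a₀ = b₀ ∧ a₁ = b₁ ∧ a₂ = b₂ ∧ a₃ = b₃ := by
  refine ⟨fun h => ⟨congrArg (·.re) h, congrArg (·.imI) h, congrArg (·.imJ) h,
    congrArg (·.imK) h⟩, ?_⟩
  rintro ⟨rfl, rfl, rfl, rfl⟩
  rfl

theorem commutator_quat (g₀ g₁ g₂ g₃ a₀ a₁ a₂ a₃ : ℚ) :
    quat g₀ g₁ g₂ g₃ * quat a₀ a₁ a₂ a₃ - quat a₀ a₁ a₂ a₃ * quat g₀ g₁ g₂ g₃ =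
      quat 0 (2 * (g₂ * a₃ - g₃ * a₂)) (2 * (g₃ * a₁ - g₁ * a₃)) (2 * (g₁ * a₂ - g₂ * a₁)) := by
  rw [quat_mul, quat_mul, quat_sub, quat_inj]
  refine ⟨?_, ?_, ?_, ?_⟩ <;> ring

theorem qi_eq : qi = quat 0 1 0 0 := rfl
theorem qj_eq : qj = quat 0 0 1 0 := rfl
theorem qk_eq : qk = quat 0 0 0 1 := rfl

theorem quat_int_mem (a₀ a₁ a₂ a₃ : ℤ) : quat a₀ a₁ a₂ a₃ ∈ lipschitz :=
  mem_lipschitz_iff.2 ⟨a₀, a₁, a₂, a₃, rfl⟩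

theorem qi_mem : qi ∈ lipschitz := by simpa [qi_eq] using quat_int_mem 0 1 0 0
theorem qj_mem : qj ∈ lipschitz := by simpa [qj_eq] using quat_int_mem 0 0 1 0

theorem two_dvd_of_half_eq {x a : ℤ} (h : (x / 2 : ℚ) = a) : 2 ∣ x := by
  rw [div_eq_iff two_ne_zero] at h
  have : x = a * 2 := by exact_mod_cast h
  exact ⟨a, by rw [this, mul_comm]⟩

theorem quat_half_mem_lipschitz_iff {x₀ x₁ x₂ x₃ : ℤ} :
    quat (x₀ / 2) (x₁ / 2) (x₂ / 2) (x₃ / 2) ∈ lipschitz ↔ 2 ∣ x₀ ∧ 2 ∣ x₁ ∧ 2 ∣ x₂ ∧ 2 ∣ x₃ := by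
  constructor
  · rintro ⟨a₀, a₁, a₂, a₃, h₀, h₁, h₂, h₃⟩
    exact ⟨two_dvd_of_half_eq h₀, two_dvd_of_half_eq h₁, two_dvd_of_half_eq h₂,
      two_dvd_of_half_eq h₃⟩
  · rintro ⟨⟨a₀, rfl⟩, ⟨a₁, rfl⟩, ⟨a₂, rfl⟩, ⟨a₃, rfl⟩⟩
    refine ⟨a₀, a₁, a₂, a₃, ?_, ?_, ?_, ?_⟩ <;> simp

/-- A pure Hurwitz quaternion with half-integral coordinates is integral. -/
theorem two_dvd_of_pure_mem_hurwitz {x₁ x₂ x₃ : ℤ}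
    (h : quat 0 (x₁ / 2) (x₂ / 2) (x₃ / 2) ∈ hurwitz) : 2 ∣ x₁ ∧ 2 ∣ x₂ ∧ 2 ∣ x₃ := by
  obtain ⟨v₁, v₂, v₃, hv⟩ := exists_int_of_mem_hurwitz h rfl
  obtain ⟨-, h₁, h₂, h₃⟩ := quat_inj.1 hv
  exact ⟨two_dvd_of_half_eq h₁, two_dvd_of_half_eq h₂, two_dvd_of_half_eq h₃⟩

/-- Squares mod 4 and mod 8, the input for the parity case splits closed by `omega`. -/
theorem sq_emod (b : ℤ) : b % 2 = 0 ∧ b ^ 2 % 4 = 0 ∨ b % 2 = 1 ∧ b ^ 2 % 8 = 1 := by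
  obtain ⟨c, rfl | rfl⟩ := Int.even_or_odd' b
  · left
    have : (2 * c) ^ 2 = 4 * c ^ 2 := by ring
    omega
  · right
    obtain ⟨e, he⟩ := Int.even_mul_succ_self c
    have : (2 * c + 1) ^ 2 = 8 * e + 1 := by linear_combination 4 * he
    omega

/-- The doubled coordinates have a common parity, so their squares sum to 0 mod 4. -/
theorem exists_int_normSq_of_mem_hurwitz {h : Quaternion ℚ} (hh : h ∈ hurwitz) :
    ∃ c : ℤ, Quaternion.normSq h = c := by
  obtain ⟨a₀, a₁, a₂, a₃, h₁, h₂, h₃, rfl⟩ := mem_hurwitz_iff.1 hh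
  have hd : (4 : ℤ) ∣ a₀ ^ 2 + a₁ ^ 2 + a₂ ^ 2 + a₃ ^ 2 := by
    rcases sq_emod a₀ with h | h <;> rcases sq_emod a₁ with h' | h' <;>
      rcases sq_emod a₂ with h'' | h'' <;> rcases sq_emod a₃ with h''' | h''' <;> omega
  obtain ⟨c, hc⟩ := hd
  refine ⟨c, ?_⟩
  have : (a₀ ^ 2 + a₁ ^ 2 + a₂ ^ 2 + a₃ ^ 2 : ℚ) = 4 * c := by exact_mod_cast hc
  rw [normSq_mk]
  linarith

/-- A Hurwitz quaternion whose norm is divisible by four is divisible by two. -/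
theorem half_mem_hurwitz {h : Quaternion ℚ} (hh : h ∈ hurwitz) {c : ℤ}
    (hc : Quaternion.normSq h = 4 * c) : quat (1 / 2) 0 0 0 * h ∈ hurwitz := by
  obtain ⟨a₀, a₁, a₂, a₃, h₁, h₂, h₃, rfl⟩ := mem_hurwitz_iff.1 hh
  rw [normSq_mk] at hc
  have hc' : a₀ ^ 2 + a₁ ^ 2 + a₂ ^ 2 + a₃ ^ 2 = 16 * c := by
    have : (a₀ ^ 2 + a₁ ^ 2 + a₂ ^ 2 + a₃ ^ 2 : ℚ) = 16 * c := by linarith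
    exact_mod_cast this
  -- Four odd squares sum to 4 mod 8, not to 16c, so the common parity of the doubled coordinates is
  -- even.
  have ha₀ : a₀ % 2 = 0 := by
    rcases sq_emod a₀ with h | h <;> rcases sq_emod a₁ with h' | h' <;>
      rcases sq_emod a₂ with h'' | h'' <;> rcases sq_emod a₃ with h''' | h''' <;> omega
  obtain ⟨b₀, rfl⟩ : 2 ∣ a₀ := by omega
  obtain ⟨b₁, rfl⟩ : 2 ∣ a₁ := by omega
  obtain ⟨b₂, rfl⟩ : 2 ∣ a₂ := by omega
  obtain ⟨b₃, rfl⟩ : 2 ∣ a₃ := by omega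
  have hb : b₀ ^ 2 + b₁ ^ 2 + b₂ ^ 2 + b₃ ^ 2 = 4 * c := by linarith
  -- Four squares sum to 0 mod 4 only when their bases share a parity.
  have hpar : 2 ∣ b₀ - b₁ ∧ 2 ∣ b₀ - b₂ ∧ 2 ∣ b₀ - b₃ := by
    rcases sq_emod b₀ with h | h <;> rcases sq_emod b₁ with h' | h' <;>
      rcases sq_emod b₂ with h'' | h'' <;> rcases sq_emod b₃ with h''' | h''' <;> omega
  refine mem_hurwitz_iff.2 ⟨b₀, b₁, b₂, b₃, hpar.1, hpar.2.1, hpar.2.2, ?_⟩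
  rw [quat_mul, quat_inj]
  push_cast
  refine ⟨?_, ?_, ?_, ?_⟩ <;> ring

/-- Commutators of Hurwitz quaternions have even norm. -/
theorem even_normSq_commutator {γ α : Quaternion ℚ} (hγ : γ ∈ hurwitz) (hα : α ∈ hurwitz) :
    ∃ c : ℤ, Quaternion.normSq (γ * α - α * γ) = 2 * c := by
  obtain ⟨g, g₁, g₂, g₃, ⟨x₁, h₁⟩, ⟨x₂, h₂⟩, ⟨x₃, h₃⟩, rfl⟩ := mem_hurwitz_iff.1 hγ
  obtain ⟨a, a₁, a₂, a₃, ⟨y₁, k₁⟩, ⟨y₂, k₂⟩, ⟨y₃, k₃⟩, rfl⟩ := mem_hurwitz_iff.1 hα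
  obtain rfl : g₁ = g - 2 * x₁ := by omega
  obtain rfl : g₂ = g - 2 * x₂ := by omega
  obtain rfl : g₃ = g - 2 * x₃ := by omega
  obtain rfl : a₁ = a - 2 * y₁ := by omega
  obtain rfl : a₂ = a - 2 * y₂ := by omega
  obtain rfl : a₃ = a - 2 * y₃ := by omega
  -- The wᵢ are the coordinates of the commutator. In their sum the terms in g and a telescope,
  -- leaving an even number.
  set w₁ : ℤ := g * (y₂ - y₃) + a * (x₃ - x₂) + 2 * (x₂ * y₃ - x₃ * y₂) with hw₁
  set w₂ : ℤ := g * (y₃ - y₁) + a * (x₁ - x₃) + 2 * (x₃ * y₁ - x₁ * y₃) with hw₂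
  set w₃ : ℤ := g * (y₁ - y₂) + a * (x₂ - x₁) + 2 * (x₁ * y₂ - x₂ * y₁) with hw₃
  have hsum : w₁ + w₂ + w₃ = 2 * (x₂ * y₃ - x₃ * y₂ + (x₃ * y₁ - x₁ * y₃) +
      (x₁ * y₂ - x₂ * y₁)) := by rw [hw₁, hw₂, hw₃]; ring
  have hd : 2 ∣ w₁ ^ 2 + w₂ ^ 2 + w₃ ^ 2 := by
    rcases sq_emod w₁ with h | h <;> rcases sq_emod w₂ with h' | h' <;>
      rcases sq_emod w₃ with h'' | h'' <;> omega
  obtain ⟨c, hc⟩ := hd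
  refine ⟨c, ?_⟩
  have hc' : (w₁ ^ 2 + w₂ ^ 2 + w₃ ^ 2 : ℚ) = 2 * c := by exact_mod_cast hc
  rw [commutator_quat, normSq_mk, ← hc', hw₁, hw₂, hw₃]
  push_cast
  ring

theorem eq_two_pow_of_not_odd_prime_dvd {n : ℕ} (hn : n ≠ 0)
    (h : ∀ p : ℕ, p.Prime → p ≠ 2 → ¬ p ∣ n) : ∃ k, n = 2 ^ k :=
  ⟨_, Nat.eq_prime_pow_of_unique_prime_dvd hn fun {d} hd hdn => by
    by_contra h2
    exact h d hd h2 hdn⟩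

theorem quat_one : quat 1 0 0 0 = 1 := by
  refine quat_ext ?_ ?_ ?_ ?_ <;> simp [Quaternion.re_one, Quaternion.imI_one,
    Quaternion.imJ_one, Quaternion.imK_one]

theorem quat_normGcd_mul_mem {R : Subring (Quaternion ℚ)} {S : Set (Quaternion ℚ)}
    (hS : S.Nontrivial) (hint : ∀ δ ∈ diffSet S, ∃ c : ℤ, Quaternion.normSq δ = c)
    (hstar : ∀ δ ∈ diffSet S, star δ ∈ R) {a : Quaternion ℚ}
    (ha : ∀ δ ∈ diffSet S, a * δ ∈ R) : quat (normGcd S) 0 0 0 * a ∈ R := by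
  have := normGcd_mul_mem hS hint hstar ha
  generalize normGcd S = g at this ⊢
  convert this using 2
  refine quat_ext ?_ ?_ ?_ ?_ <;> simp

/-! ### The Hurwitz case -/

/-- The Hurwitz case in terms of commutators. -/
theorem hurwitz_comm_iff {S : Set (Quaternion ℚ)} {t n : ℤ} (hnt : S.Nontrivial)
    (hSR : S ⊆ (hurwitz : Set (Quaternion ℚ)))
    (hS : ∀ α ∈ S, 2 * α.re = t ∧ Quaternion.normSq α = n)
    (hred : ∀ a n : ℤ, 2 ≤ n → ¬ (fun α : Quaternion ℚ => α + (a : Quaternion ℚ)) '' S ⊆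
      (fun γ : Quaternion ℚ => (n : Quaternion ℚ) * γ) '' (hurwitz : Set (Quaternion ℚ))) :
    (∀ a, (∀ δ ∈ diffSet S, a * δ ∈ hurwitz) →
      ∀ α ∈ S, ∀ γ ∈ hurwitz, a * (γ * α - α * γ) ∈ hurwitz) ↔
      normGcd S = 1 ∨ normGcd S = 2 := by
  have hdH : ∀ δ ∈ diffSet S, δ ∈ hurwitz := by
    rintro _ ⟨x, hx, y, hy, rfl⟩
    exact hurwitz.sub_mem (hSR hx) (hSR hy)
  have hint : ∀ δ ∈ diffSet S, ∃ c : ℤ, Quaternion.normSq δ = c := fun δ hδ =>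
    exists_int_normSq_of_mem_hurwitz (hdH δ hδ)
  have hdvd := dvd_normGcd_iff hnt hint
  constructor
  · intro hcomm
    have hodd : ∀ p : ℕ, p.Prime → p ≠ 2 → ¬ p ∣ normGcd S := fun p hp hp2 hpd =>
      not_odd_prime_dvd lipschitz_le_hurwitz le_rfl hSR (fun α hα => (hS α hα).1) hred hcomm hp hp2
        ((hdvd p).1 hpd)
    have h4 : ¬ 4 ∣ normGcd S := by
      intro h4
      rw [hdvd] at h4
      have h := hcomm (quat (1 / 2) 0 0 0) fun δ hδ => by
        obtain ⟨c, hc⟩ := h4 δ hδ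
        exact half_mem_hurwitz (hdH δ hδ) (c := c) (by exact_mod_cast hc)
      -- Why translate by the norm n: once α is integral with b₁ ≡ b₂ ≡ b₃ mod 2, n ≡ b₀ + b₁, so b₀
      -- + n has the parity of the imaginary coordinates and α + n ∈ 2H.
      refine hred n 2 le_rfl ?_
      rintro _ ⟨α, hα, rfl⟩
      have hn := (hS α hα).2
      obtain ⟨a₀, a₁, a₂, a₃, d₁, d₂, d₃, rfl⟩ := mem_hurwitz_iff.1 (hSR hα)
      have hi := h _ hα qi (lipschitz_le_hurwitz qi_mem)
      have hj := h _ hα qj (lipschitz_le_hurwitz qj_mem)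
      -- i and j force α to be integral; (1 + i + j + k)/2 makes its imaginary coordinates congruent
      -- mod 2.
      have hw := h _ hα (quat (1 / 2) (1 / 2) (1 / 2) (1 / 2))
        (mem_hurwitz_iff.2 ⟨1, 1, 1, 1, by simp, by simp, by simp, by simp⟩)
      rw [qi_eq, commutator_quat, quat_mul] at hi
      rw [qj_eq, commutator_quat, quat_mul] at hj
      rw [commutator_quat, quat_mul] at hw
      obtain ⟨-, e₁, e₂⟩ := two_dvd_of_pure_mem_hurwitz (x₁ := 0) (x₂ := -a₃) (x₃ := a₂)
        (by convert hi using 2 <;> push_cast <;> ring)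
      obtain ⟨-, -, e₃⟩ := two_dvd_of_pure_mem_hurwitz (x₁ := a₃) (x₂ := 0) (x₃ := -a₁)
        (by convert hj using 2 <;> push_cast <;> ring)
      obtain ⟨b₀, rfl⟩ : 2 ∣ a₀ := by omega
      obtain ⟨b₁, rfl⟩ : 2 ∣ a₁ := by omega
      obtain ⟨b₂, rfl⟩ : 2 ∣ a₂ := by omega
      obtain ⟨b₃, rfl⟩ : 2 ∣ a₃ := by omega
      obtain ⟨f₁, f₂, f₃⟩ := two_dvd_of_pure_mem_hurwitz (x₁ := b₃ - b₂) (x₂ := b₁ - b₃)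
        (x₃ := b₂ - b₁) (by convert hw using 2 <;> push_cast <;> ring)
      rw [normSq_mk] at hn
      have hn' : b₀ ^ 2 + b₁ ^ 2 + b₂ ^ 2 + b₃ ^ 2 = n := by
        have : (b₀ ^ 2 + b₁ ^ 2 + b₂ ^ 2 + b₃ ^ 2 : ℚ) = n := by
          rw [← hn]; push_cast; ring
        exact_mod_cast this
      have hpar : 2 ∣ b₀ + n - b₁ := by
        rcases sq_emod b₀ with h | h <;> rcases sq_emod b₁ with h' | h' <;>
          rcases sq_emod b₂ with h'' | h'' <;> rcases sq_emod b₃ with h''' | h''' <;> omega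
      refine ⟨quat ((b₀ + n : ℤ) / 2) (b₁ / 2) (b₂ / 2) (b₃ / 2),
        mem_hurwitz_iff.2 ⟨b₀ + n, b₁, b₂, b₃, hpar, by omega, by omega, rfl⟩, ?_⟩
      simp only [intCast_eq_quat, quat_mul, quat_add, quat_inj]
      push_cast
      refine ⟨?_, ?_, ?_, ?_⟩ <;> ring
    obtain ⟨k, hk⟩ := eq_two_pow_of_not_odd_prime_dvd (normGcd_ne_zero hnt hint) hodd
    match k, hk with
    | 0, hk => exact Or.inl hk
    | 1, hk => exact Or.inr hk
    | k + 2, hk => exact absurd ⟨2 ^ k, by rw [hk]; ring⟩ h4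
  · intro hΓ a ha α hα γ hγ
    have hstar : ∀ δ ∈ diffSet S, star δ ∈ hurwitz := by
      intro δ hδ
      obtain ⟨v₁, v₂, v₃, rfl⟩ := exists_int_of_mem_diffSet le_rfl hSR (fun α hα => (hS α hα).1) hδ
      convert hurwitz.neg_mem (hdH _ hδ) using 1
      refine quat_ext ?_ ?_ ?_ ?_ <;> simp
    have hΓa := quat_normGcd_mul_mem hnt hint hstar ha
    have hcH : γ * α - α * γ ∈ hurwitz :=
      hurwitz.sub_mem (hurwitz.mul_mem hγ (hSR hα)) (hurwitz.mul_mem (hSR hα) hγ)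
    rcases hΓ with hΓ | hΓ
    · rw [hΓ] at hΓa
      exact hurwitz.mul_mem (by simpa [quat_one] using hΓa) hcH
    · rw [hΓ] at hΓa
      -- Some δ has N(δ) = 2c with c odd. Then N(2a)N(δ) = 4N(aδ) makes N(2a) even.
      have h4 : ¬ 4 ∣ normGcd S := by rw [hΓ]; norm_num
      have h2 : 2 ∣ normGcd S := by rw [hΓ]
      rw [hdvd] at h4 h2
      push Not at h4
      obtain ⟨δ, hδ, hδ4⟩ := h4
      obtain ⟨c, hc⟩ := h2 δ hδ
      obtain ⟨e, he⟩ := exists_int_normSq_of_mem_hurwitz (ha δ hδ)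
      obtain ⟨f, hf⟩ := exists_int_normSq_of_mem_hurwitz hΓa
      obtain ⟨u, hu⟩ := even_normSq_commutator hγ (hSR hα)
      have hfa : (f : ℚ) = 4 * Quaternion.normSq a := by
        rw [← hf, map_mul]
        congr 1
        rw [normSq_mk]
        norm_num
      have hcf : c * f = 2 * e := by
        rw [map_mul, hc] at he
        have : (c * f : ℚ) = 2 * e := by rw [hfa, ← he]; push_cast; ring
        exact_mod_cast this
      have hcodd : ¬ 2 ∣ c := by
        rintro ⟨d, rfl⟩
        exact hδ4 d (by rw [hc]; push_cast; ring)
      obtain ⟨f', rfl⟩ : 2 ∣ f := (Int.prime_two.dvd_or_dvd ⟨e, hcf⟩).resolve_left hcodd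
      have := half_mem_hurwitz (hurwitz.mul_mem hΓa hcH) (c := f' * u) (by
        rw [map_mul, hf, hu]; push_cast; ring)
      rw [← mul_assoc, ← mul_assoc] at this
      convert this using 2
      rw [quat_mul]
      norm_num [quat_one]

/-! ### The Lipschitz case: necessity -/

/-- In a reduced set of Lipschitz quaternions some imaginary coordinate is odd. -/
theorem exists_odd_of_reduced {S : Set (Quaternion ℚ)} {t : ℤ} (hne : S.Nonempty)
    (hSR : S ⊆ (lipschitz : Set (Quaternion ℚ))) (hS : ∀ α ∈ S, 2 * α.re = t)
    (hred : ∀ a n : ℤ, 2 ≤ n → ¬ (fun α : Quaternion ℚ => α + (a : Quaternion ℚ)) '' S ⊆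
      (fun γ : Quaternion ℚ => (n : Quaternion ℚ) * γ) '' (lipschitz : Set (Quaternion ℚ))) :
    ∃ a₀ a₁ a₂ a₃ : ℤ, quat a₀ a₁ a₂ a₃ ∈ S ∧ ¬ (2 ∣ a₁ ∧ 2 ∣ a₂ ∧ 2 ∣ a₃) := by
  by_contra! hcon
  obtain ⟨β, hβ⟩ := hne
  obtain ⟨b₀, b₁, b₂, b₃, rfl⟩ := mem_lipschitz_iff.1 (hSR hβ)
  refine hred (-b₀) 2 le_rfl ?_
  rintro _ ⟨α, hα, rfl⟩
  obtain ⟨a₀, a₁, a₂, a₃, rfl⟩ := mem_lipschitz_iff.1 (hSR hα)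
  obtain ⟨⟨c₁, rfl⟩, ⟨c₂, rfl⟩, ⟨c₃, rfl⟩⟩ := hcon _ _ _ _ hα
  have h1 := hS _ hα
  have h2 := hS _ hβ
  rw [re_quat] at h1 h2
  refine ⟨quat (0 : ℤ) c₁ c₂ c₃, quat_int_mem _ _ _ _, ?_⟩
  simp only [intCast_eq_quat, quat_mul, quat_add, quat_inj]
  push_cast
  refine ⟨?_, ?_, ?_, ?_⟩ <;> linarith

/-- N(x − y) = 2n − 2⟨x, y⟩ with ⟨x, y⟩ an integer. This is what excludes Γ = 1 for Lipschitz
quaternions. -/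
theorem even_normSq_of_mem_diffSet {S : Set (Quaternion ℚ)} {t n : ℤ}
    (hSR : S ⊆ (lipschitz : Set (Quaternion ℚ)))
    (hS : ∀ α ∈ S, 2 * α.re = t ∧ Quaternion.normSq α = n) {δ : Quaternion ℚ}
    (hδ : δ ∈ diffSet S) : ∃ c : ℤ, Quaternion.normSq δ = 2 * c := by
  obtain ⟨x, hx, y, hy, rfl⟩ := hδ
  obtain ⟨hxt, hxn⟩ := hS x hx
  obtain ⟨hyt, hyn⟩ := hS y hy
  obtain ⟨a₀, a₁, a₂, a₃, rfl⟩ := mem_lipschitz_iff.1 (hSR hx)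
  obtain ⟨b₀, b₁, b₂, b₃, rfl⟩ := mem_lipschitz_iff.1 (hSR hy)
  rw [normSq_mk] at hxn hyn
  refine ⟨n - a₀ * b₀ - a₁ * b₁ - a₂ * b₂ - a₃ * b₃, ?_⟩
  rw [quat_sub, normSq_mk]
  push_cast
  linarith

/-- Differences whose norm is divisible by four are twice a Lipschitz quaternion. -/
theorem exists_two_mul_of_four_dvd {S : Set (Quaternion ℚ)} {t : ℤ}
    (hSR : S ⊆ (lipschitz : Set (Quaternion ℚ))) (hS : ∀ α ∈ S, 2 * α.re = t)
    {δ : Quaternion ℚ} (hδ : δ ∈ diffSet S) {c : ℤ} (hc : Quaternion.normSq δ = 4 * c) :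
    ∃ d₁ d₂ d₃ : ℤ, δ = quat 0 (2 * d₁) (2 * d₂) (2 * d₃) ∧ d₁ ^ 2 + d₂ ^ 2 + d₃ ^ 2 = c := by
  obtain ⟨v₁, v₂, v₃, rfl⟩ := exists_int_of_mem_diffSet lipschitz_le_hurwitz hSR hS hδ
  rw [normSq_mk] at hc
  have hc' : v₁ ^ 2 + v₂ ^ 2 + v₃ ^ 2 = 4 * c := by
    have : (v₁ ^ 2 + v₂ ^ 2 + v₃ ^ 2 : ℚ) = 4 * c := by linarith
    exact_mod_cast this
  have hpar : 2 ∣ v₁ ∧ 2 ∣ v₂ ∧ 2 ∣ v₃ := by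
    rcases sq_emod v₁ with h | h <;> rcases sq_emod v₂ with h' | h' <;>
      rcases sq_emod v₃ with h'' | h'' <;> omega
  obtain ⟨⟨d₁, rfl⟩, ⟨d₂, rfl⟩, ⟨d₃, rfl⟩⟩ := hpar
  exact ⟨d₁, d₂, d₃, by push_cast; rfl, by linarith⟩

/-- After halving, only coordinates mod 2 matter; the three listed residues become the nonzero
vectors of even weight in 𝔽₂³. -/
theorem congMod4_iff {d₁ d₂ d₃ r₁ r₂ r₃ : ℤ} :
    CongMod4 (quat 0 (2 * d₁) (2 * d₂) (2 * d₃)) (quat 0 (2 * r₁) (2 * r₂) (2 * r₃)) ↔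
      2 ∣ d₁ - r₁ ∧ 2 ∣ d₂ - r₂ ∧ 2 ∣ d₃ - r₃ := by
  constructor
  · rintro ⟨ε, hε, h⟩
    obtain ⟨e₀, e₁, e₂, e₃, rfl⟩ := mem_lipschitz_iff.1 hε
    have h4 : (4 : Quaternion ℚ) = quat 4 0 0 0 := by simpa using intCast_eq_quat 4
    rw [h4, quat_sub, quat_mul, quat_inj] at h
    obtain ⟨-, h₁, h₂, h₃⟩ := h
    have key : ∀ d r e : ℤ, (2 * d - 2 * r : ℚ) = 4 * e → 2 ∣ d - r := fun d r e h => by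
      have : 2 * d - 2 * r = 4 * e := by exact_mod_cast h
      omega
    exact ⟨key _ _ e₁ (by linarith), key _ _ e₂ (by linarith), key _ _ e₃ (by linarith)⟩
  · rintro ⟨⟨e₁, h₁⟩, ⟨e₂, h₂⟩, ⟨e₃, h₃⟩⟩
    obtain rfl : d₁ = r₁ + 2 * e₁ := by omega
    obtain rfl : d₂ = r₂ + 2 * e₂ := by omega
    obtain rfl : d₃ = r₃ + 2 * e₃ := by omega
    refine ⟨quat (0 : ℤ) e₁ e₂ e₃, quat_int_mem _ _ _ _, ?_⟩
    have h4 : (4 : Quaternion ℚ) = quat 4 0 0 0 := by simpa using intCast_eq_quat 4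
    rw [h4, quat_sub, quat_mul, quat_inj]
    push_cast
    refine ⟨?_, ?_, ?_, ?_⟩ <;> ring

theorem two_eq_quat : (2 : Quaternion ℚ) = quat 2 0 0 0 := by simpa using intCast_eq_quat 2

theorem two_mul_qi_add_qj :
    2 * qi + 2 * qj = quat 0 (2 * (1 : ℤ)) (2 * (1 : ℤ)) (2 * (0 : ℤ)) := by
  rw [two_eq_quat, qi_eq, qj_eq, quat_mul, quat_mul, quat_add]; norm_num

theorem two_mul_qi_add_qk :
    2 * qi + 2 * qk = quat 0 (2 * (1 : ℤ)) (2 * (0 : ℤ)) (2 * (1 : ℤ)) := by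
  rw [two_eq_quat, qi_eq, qk_eq, quat_mul, quat_mul, quat_add]; norm_num

theorem two_mul_qj_add_qk :
    2 * qj + 2 * qk = quat 0 (2 * (0 : ℤ)) (2 * (1 : ℤ)) (2 * (1 : ℤ)) := by
  rw [two_eq_quat, qj_eq, qk_eq, quat_mul, quat_mul, quat_add]; norm_num

/-- If all differences are even with a common even coordinate, the commutator criterion fails. -/
theorem not_comm_of_even {S : Set (Quaternion ℚ)} {t : ℤ} (hne : S.Nonempty)
    (hSR : S ⊆ (lipschitz : Set (Quaternion ℚ))) (hS : ∀ α ∈ S, 2 * α.re = t)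
    (hred : ∀ a n : ℤ, 2 ≤ n → ¬ (fun α : Quaternion ℚ => α + (a : Quaternion ℚ)) '' S ⊆
      (fun γ : Quaternion ℚ => (n : Quaternion ℚ) * γ) '' (lipschitz : Set (Quaternion ℚ)))
    (hcomm : ∀ a, (∀ δ ∈ diffSet S, a * δ ∈ lipschitz) →
      ∀ α ∈ S, ∀ γ ∈ lipschitz, a * (γ * α - α * γ) ∈ lipschitz)
    {x y z : ℤ} (hxyz : x = 1 ∧ y = 0 ∧ z = 0 ∨ x = 0 ∧ y = 1 ∧ z = 0 ∨ x = 0 ∧ y = 0 ∧ z = 1)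
    (hδ : ∀ δ ∈ diffSet S, ∃ d₁ d₂ d₃ : ℤ, δ = quat 0 (2 * d₁) (2 * d₂) (2 * d₃) ∧
      2 ∣ d₁ + d₂ + d₃ ∧ 2 ∣ x * d₁ + y * d₂ + z * d₃) : False := by
  obtain ⟨a₀, a₁, a₂, a₃, hα, hodd⟩ := exists_odd_of_reduced hne hSR hS hred
  -- The multiplier is (1 + u)/4, where u = xi + yj + zk is the unit of the common even coordinate.
  -- On δ = 2d it gives (d + ud)/2, integral because that coordinate and the sum of all three are
  -- even.
  have h := hcomm (quat (1 / 4) (x / 4) (y / 4) (z / 4)) fun δ h => by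
    obtain ⟨d₁, d₂, d₃, rfl, h₁, h₂⟩ := hδ δ h
    have := (quat_half_mem_lipschitz_iff (x₀ := -(x * d₁ + y * d₂ + z * d₃))
      (x₁ := d₁ + y * d₃ - z * d₂) (x₂ := d₂ - x * d₃ + z * d₁)
      (x₃ := d₃ + x * d₂ - y * d₁)).2 (by
        rcases hxyz with ⟨rfl, rfl, rfl⟩ | ⟨rfl, rfl, rfl⟩ | ⟨rfl, rfl, rfl⟩ <;> omega)
    rw [quat_mul]
    convert this using 2 <;> push_cast <;> ring
  have hi := h _ hα _ qi_mem
  have hj := h _ hα _ qj_mem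
  rw [qi_eq, commutator_quat, quat_mul] at hi
  rw [qj_eq, commutator_quat, quat_mul] at hj
  have hi' := (quat_half_mem_lipschitz_iff (x₀ := y * a₃ - z * a₂)
      (x₁ := y * a₂ + z * a₃) (x₂ := -a₃ - x * a₂)
      (x₃ := a₂ - x * a₃)).1 (by convert hi using 2 <;> push_cast <;> ring)
  have hj' := (quat_half_mem_lipschitz_iff (x₀ := z * a₁ - x * a₃)
      (x₁ := a₃ - y * a₁) (x₂ := x * a₁ + z * a₃)
      (x₃ := -a₁ - y * a₃)).1 (by convert hj using 2 <;> push_cast <;> ring)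
  refine hodd ?_
  rcases hxyz with ⟨rfl, rfl, rfl⟩ | ⟨rfl, rfl, rfl⟩ | ⟨rfl, rfl, rfl⟩ <;> omega

/-- Each half-difference has even weight mod 2. If at most one nonzero class occurred, all would
share an even coordinate (the one where that class vanishes), contradicting `not_comm_of_even`. -/
theorem meetsTwoResidues_of_comm {S : Set (Quaternion ℚ)} {t : ℤ} (hne : S.Nonempty)
    (hSR : S ⊆ (lipschitz : Set (Quaternion ℚ))) (hS : ∀ α ∈ S, 2 * α.re = t)
    (hred : ∀ a n : ℤ, 2 ≤ n → ¬ (fun α : Quaternion ℚ => α + (a : Quaternion ℚ)) '' S ⊆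
      (fun γ : Quaternion ℚ => (n : Quaternion ℚ) * γ) '' (lipschitz : Set (Quaternion ℚ)))
    (hcomm : ∀ a, (∀ δ ∈ diffSet S, a * δ ∈ lipschitz) →
      ∀ α ∈ S, ∀ γ ∈ lipschitz, a * (γ * α - α * γ) ∈ lipschitz)
    (h8 : ∀ δ ∈ diffSet S, ∃ c : ℤ, Quaternion.normSq δ = 8 * c) : MeetsTwoResidues S := by
  have hδ : ∀ δ ∈ diffSet S, ∃ d₁ d₂ d₃ : ℤ, δ = quat 0 (2 * d₁) (2 * d₂) (2 * d₃) ∧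
      2 ∣ d₁ + d₂ + d₃ := by
    intro δ hδ
    obtain ⟨c, hc⟩ := h8 δ hδ
    obtain ⟨d₁, d₂, d₃, hd, hsum⟩ := exists_two_mul_of_four_dvd hSR hS hδ (c := 2 * c)
      (by rw [hc]; push_cast; ring)
    refine ⟨d₁, d₂, d₃, hd, ?_⟩
    rcases sq_emod d₁ with h | h <;> rcases sq_emod d₂ with h' | h' <;>
      rcases sq_emod d₃ with h'' | h'' <;> omega
  by_contra hM
  have hne₁ : 2 * qi + 2 * qj ≠ 2 * qi + 2 * qk := by
    rw [two_mul_qi_add_qj, two_mul_qi_add_qk, Ne, quat_inj]; norm_num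
  have hne₂ : 2 * qi + 2 * qj ≠ 2 * qj + 2 * qk := by
    rw [two_mul_qi_add_qj, two_mul_qj_add_qk, Ne, quat_inj]; norm_num
  have hne₃ : 2 * qi + 2 * qk ≠ 2 * qj + 2 * qk := by
    rw [two_mul_qi_add_qk, two_mul_qj_add_qk, Ne, quat_inj]; norm_num
  have hcases : (∀ δ ∈ diffSet S, ¬ CongMod4 δ (2 * qi + 2 * qj) ∧
        ¬ CongMod4 δ (2 * qi + 2 * qk)) ∨
      (∀ δ ∈ diffSet S, ¬ CongMod4 δ (2 * qi + 2 * qj) ∧ ¬ CongMod4 δ (2 * qj + 2 * qk)) ∨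
      (∀ δ ∈ diffSet S, ¬ CongMod4 δ (2 * qi + 2 * qk) ∧ ¬ CongMod4 δ (2 * qj + 2 * qk)) := by
    by_cases h₁ : ∃ δ ∈ diffSet S, CongMod4 δ (2 * qi + 2 * qj)
    · obtain ⟨δ₁, m₁, c₁⟩ := h₁
      exact Or.inr (Or.inr fun δ hδ =>
        ⟨fun hc => hM ⟨_, by simp, _, by simp, hne₁, δ₁, m₁, δ, hδ, c₁, hc⟩,
          fun hc => hM ⟨_, by simp, _, by simp, hne₂, δ₁, m₁, δ, hδ, c₁, hc⟩⟩)
    · push Not at h₁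
      by_cases h₂ : ∃ δ ∈ diffSet S, CongMod4 δ (2 * qi + 2 * qk)
      · obtain ⟨δ₁, m₁, c₁⟩ := h₂
        exact Or.inr (Or.inl fun δ hδ => ⟨h₁ δ hδ,
          fun hc => hM ⟨_, by simp, _, by simp, hne₃, δ₁, m₁, δ, hδ, c₁, hc⟩⟩)
      · push Not at h₂
        exact Or.inl fun δ hδ => ⟨h₁ δ hδ, h₂ δ hδ⟩
  rw [two_mul_qi_add_qj, two_mul_qi_add_qk, two_mul_qj_add_qk] at hcases
  rcases hcases with hc | hc | hc
  · refine not_comm_of_even hne hSR hS hred hcomm (x := 1) (y := 0) (z := 0) (by simp) ?_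
    intro δ m
    obtain ⟨d₁, d₂, d₃, rfl, hd⟩ := hδ δ m
    have := hc _ m
    rw [congMod4_iff, congMod4_iff] at this
    exact ⟨d₁, d₂, d₃, rfl, hd, by omega⟩
  · refine not_comm_of_even hne hSR hS hred hcomm (x := 0) (y := 1) (z := 0) (by simp) ?_
    intro δ m
    obtain ⟨d₁, d₂, d₃, rfl, hd⟩ := hδ δ m
    have := hc _ m
    rw [congMod4_iff, congMod4_iff] at this
    exact ⟨d₁, d₂, d₃, rfl, hd, by omega⟩
  · refine not_comm_of_even hne hSR hS hred hcomm (x := 0) (y := 0) (z := 1) (by simp) ?_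
    intro δ m
    obtain ⟨d₁, d₂, d₃, rfl, hd⟩ := hδ δ m
    have := hc _ m
    rw [congMod4_iff, congMod4_iff] at this
    exact ⟨d₁, d₂, d₃, rfl, hd, by omega⟩

theorem exists_coords_of_mem_residues {ρ : Quaternion ℚ}
    (hρ : ρ ∈ ({2 * qi + 2 * qj, 2 * qi + 2 * qk, 2 * qj + 2 * qk} : Set (Quaternion ℚ))) :
    ∃ r₁ r₂ r₃ : ℤ, ρ = quat 0 (2 * r₁) (2 * r₂) (2 * r₃) ∧
      (r₁ = 1 ∧ r₂ = 1 ∧ r₃ = 0 ∨ r₁ = 1 ∧ r₂ = 0 ∧ r₃ = 1 ∨ r₁ = 0 ∧ r₂ = 1 ∧ r₃ = 1) := by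
  rcases hρ with rfl | rfl | rfl
  · exact ⟨1, 1, 0, two_mul_qi_add_qj, by simp⟩
  · exact ⟨1, 0, 1, two_mul_qi_add_qk, by simp⟩
  · exact ⟨0, 1, 1, two_mul_qj_add_qk, by simp⟩

/-- A difference 2d in one of the residue classes has exactly two odd dᵢ, so N(d) ≡ 2 mod 4 and its
norm is 8 mod 16. -/
theorem not_sixteen_dvd_of_meetsTwoResidues {S : Set (Quaternion ℚ)} {t : ℤ}
    (hSR : S ⊆ (lipschitz : Set (Quaternion ℚ))) (hS : ∀ α ∈ S, 2 * α.re = t)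
    (hM : MeetsTwoResidues S) :
    ¬ ∀ δ ∈ diffSet S, ∃ c : ℤ, Quaternion.normSq δ = 16 * c := by
  intro h16
  obtain ⟨ρ, hρ, -, -, -, δ, hδ, -, -, hcong, -⟩ := hM
  obtain ⟨r₁, r₂, r₃, rfl, hr⟩ := exists_coords_of_mem_residues hρ
  obtain ⟨c, hc⟩ := h16 δ hδ
  obtain ⟨d₁, d₂, d₃, rfl, hd⟩ := exists_two_mul_of_four_dvd hSR hS hδ (c := 4 * c)
    (by rw [hc]; push_cast; ring)
  rw [congMod4_iff] at hcong
  rcases sq_emod d₁ with h | h <;> rcases sq_emod d₂ with h' | h' <;>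
    rcases sq_emod d₃ with h'' | h'' <;> omega

/-! ### The Lipschitz case: sufficiency -/

/-- Consequences of a difference being congruent to one of the distinguished residues. -/
theorem parity_of_congMod4 {S : Set (Quaternion ℚ)} {t n : ℤ}
    (hSR : S ⊆ (lipschitz : Set (Quaternion ℚ)))
    (hS : ∀ α ∈ S, 2 * α.re = t ∧ Quaternion.normSq α = n)
    (h4 : ∀ δ ∈ diffSet S, ∃ c : ℤ, Quaternion.normSq δ = 4 * c) {b₀ b₁ b₂ b₃ : ℤ}
    (hb : ∀ δ ∈ diffSet S, quat (b₀ / 4) (b₁ / 4) (b₂ / 4) (b₃ / 4) * δ ∈ lipschitz)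
    {a₀ a₁ a₂ a₃ : ℤ} (hα : quat a₀ a₁ a₂ a₃ ∈ S) {δ : Quaternion ℚ} (hδ : δ ∈ diffSet S)
    {r₁ r₂ r₃ : ℤ} (hr : 2 ∣ r₁ + r₂ + r₃)
    (hcong : CongMod4 δ (quat 0 (2 * r₁) (2 * r₂) (2 * r₃))) :
    2 ∣ r₁ * a₁ + r₂ * a₂ + r₃ * a₃ ∧ 2 ∣ b₁ * r₁ + b₂ * r₂ + b₃ * r₃ ∧
      2 ∣ b₀ * r₁ + b₂ * r₃ - b₃ * r₂ ∧ 2 ∣ b₀ * r₂ - b₁ * r₃ + b₃ * r₁ ∧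
      2 ∣ b₀ * r₃ + b₁ * r₂ - b₂ * r₁ := by
  have hS' : ∀ α ∈ S, 2 * α.re = t := fun α hα => (hS α hα).1
  have hbδ := hb δ hδ
  obtain ⟨x, hx, y, hy, rfl⟩ := hδ
  obtain ⟨c, hc⟩ := h4 _ ⟨x, hx, y, hy, rfl⟩
  obtain ⟨d₁, d₂, d₃, hd, -⟩ := exists_two_mul_of_four_dvd hSR hS' ⟨x, hx, y, hy, rfl⟩ hc
  obtain ⟨c', hc'⟩ := h4 _ ⟨_, hα, y, hy, rfl⟩
  obtain ⟨f₁, f₂, f₃, hf, -⟩ := exists_two_mul_of_four_dvd hSR hS' ⟨_, hα, y, hy, rfl⟩ hc'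
  rw [hd] at hcong hbδ
  obtain ⟨⟨e₁, h₁⟩, ⟨e₂, h₂⟩, ⟨e₃, h₃⟩⟩ := congMod4_iff.1 hcong
  obtain rfl : d₁ = r₁ + 2 * e₁ := by omega
  obtain rfl : d₂ = r₂ + 2 * e₂ := by omega
  obtain rfl : d₃ = r₃ + 2 * e₃ := by omega
  constructor
  · have hxn := (hS x hx).2
    have hyn := (hS y hy).2
    obtain ⟨y₀, y₁, y₂, y₃, rfl⟩ := mem_lipschitz_iff.1 (hSR hy)
    rw [sub_eq_iff_eq_add, quat_add] at hd hf
    rw [hd, normSq_mk] at hxn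
    rw [normSq_mk] at hyn
    rw [quat_inj] at hf
    have g₁ : a₁ = 2 * f₁ + y₁ := by exact_mod_cast hf.2.1
    have g₂ : a₂ = 2 * f₂ + y₂ := by exact_mod_cast hf.2.2.1
    have g₃ : a₃ = 2 * f₃ + y₃ := by exact_mod_cast hf.2.2.2
    -- N(y + 2d) = N(y) gives d·y = −N(d), which is even. Since α ≡ y and d ≡ r mod 2, r·α is even
    -- too.
    have hq : ((r₁ + 2 * e₁) * y₁ + (r₂ + 2 * e₂) * y₂ + (r₃ + 2 * e₃) * y₃ : ℚ) +
        ((r₁ + 2 * e₁) ^ 2 + (r₂ + 2 * e₂) ^ 2 + (r₃ + 2 * e₃) ^ 2) = 0 := by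
      push_cast at hxn
      linarith
    have hz : ((r₁ + 2 * e₁) * y₁ + (r₂ + 2 * e₂) * y₂ + (r₃ + 2 * e₃) * y₃) +
        ((r₁ + 2 * e₁) ^ 2 + (r₂ + 2 * e₂) ^ 2 + (r₃ + 2 * e₃) ^ 2) = 0 := by
      exact_mod_cast hq
    have hsq : 2 ∣ (r₁ + 2 * e₁) ^ 2 + (r₂ + 2 * e₂) ^ 2 + (r₃ + 2 * e₃) ^ 2 := by
      rcases sq_emod (r₁ + 2 * e₁) with h | h <;> rcases sq_emod (r₂ + 2 * e₂) with h' | h' <;>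
        rcases sq_emod (r₃ + 2 * e₃) with h'' | h'' <;> omega
    obtain ⟨s, hs⟩ := hsq
    refine ⟨r₁ * f₁ + r₂ * f₂ + r₃ * f₃ - s - e₁ * y₁ - e₂ * y₂ - e₃ * y₃, ?_⟩
    rw [g₁, g₂, g₃]
    linear_combination hz - hs
  · rw [quat_mul] at hbδ
    obtain ⟨⟨m₀, k₀⟩, ⟨m₁, k₁⟩, ⟨m₂, k₂⟩, ⟨m₃, k₃⟩⟩ := (quat_half_mem_lipschitz_iff
      (x₀ := -(b₁ * (r₁ + 2 * e₁) + b₂ * (r₂ + 2 * e₂) + b₃ * (r₃ + 2 * e₃)))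
      (x₁ := b₀ * (r₁ + 2 * e₁) + b₂ * (r₃ + 2 * e₃) - b₃ * (r₂ + 2 * e₂))
      (x₂ := b₀ * (r₂ + 2 * e₂) - b₁ * (r₃ + 2 * e₃) + b₃ * (r₁ + 2 * e₁))
      (x₃ := b₀ * (r₃ + 2 * e₃) + b₁ * (r₂ + 2 * e₂) - b₂ * (r₁ + 2 * e₁))).1
        (by convert hbδ using 2 <;> push_cast <;> ring)
    refine ⟨⟨-m₀ - b₁ * e₁ - b₂ * e₂ - b₃ * e₃, ?_⟩, ⟨m₁ - b₀ * e₁ - b₂ * e₃ + b₃ * e₂, ?_⟩,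
      ⟨m₂ - b₀ * e₂ + b₁ * e₃ - b₃ * e₁, ?_⟩, ⟨m₃ - b₀ * e₃ - b₁ * e₂ + b₂ * e₁, ?_⟩⟩ <;>
      linarith

/-- If two distinguished residues occur, a quarter-integral multiplier of the differences sends
all commutators into the Lipschitz ring. -/
theorem mul_commutator_mem_of_meetsTwoResidues {S : Set (Quaternion ℚ)} {t n : ℤ}
    (hSR : S ⊆ (lipschitz : Set (Quaternion ℚ)))
    (hS : ∀ α ∈ S, 2 * α.re = t ∧ Quaternion.normSq α = n)
    (h4 : ∀ δ ∈ diffSet S, ∃ c : ℤ, Quaternion.normSq δ = 4 * c)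
    (hM : MeetsTwoResidues S) {b₀ b₁ b₂ b₃ : ℤ}
    (hb : ∀ δ ∈ diffSet S, quat (b₀ / 4) (b₁ / 4) (b₂ / 4) (b₃ / 4) * δ ∈ lipschitz)
    {α γ : Quaternion ℚ} (hα : α ∈ S) (hγ : γ ∈ lipschitz) :
    quat (b₀ / 4) (b₁ / 4) (b₂ / 4) (b₃ / 4) * (γ * α - α * γ) ∈ lipschitz := by
  obtain ⟨a₀, a₁, a₂, a₃, rfl⟩ := mem_lipschitz_iff.1 (hSR hα)
  obtain ⟨g₀, g₁, g₂, g₃, rfl⟩ := mem_lipschitz_iff.1 hγ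
  obtain ⟨ρ, hρ, σ, hσ, hne, δ₁, hδ₁, δ₂, hδ₂, hc₁, hc₂⟩ := hM
  obtain ⟨r₁, r₂, r₃, rfl, hr⟩ := exists_coords_of_mem_residues hρ
  obtain ⟨s₁, s₂, s₃, rfl, hs⟩ := exists_coords_of_mem_residues hσ
  have hp := parity_of_congMod4 hSR hS h4 hb hα hδ₁ (by omega) hc₁
  have hq := parity_of_congMod4 hSR hS h4 hb hα hδ₂ (by omega) hc₂
  -- Two distinct residues span the even-weight plane mod 2, so the imaginary coordinates of α agree
  -- mod 2, as do all four bᵢ.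
  have hres : 2 ∣ a₂ - a₁ ∧ 2 ∣ a₃ - a₁ ∧ 2 ∣ b₁ - b₀ ∧ 2 ∣ b₂ - b₀ ∧ 2 ∣ b₃ - b₀ := by
    rcases hr with ⟨rfl, rfl, rfl⟩ | ⟨rfl, rfl, rfl⟩ | ⟨rfl, rfl, rfl⟩ <;>
      rcases hs with ⟨rfl, rfl, rfl⟩ | ⟨rfl, rfl, rfl⟩ | ⟨rfl, rfl, rfl⟩ <;>
      first
      | exact absurd rfl hne
      | omega
  clear hp hq hc₁ hc₂
  obtain ⟨⟨u₂, k₂⟩, ⟨u₃, k₃⟩, ⟨v₁, l₁⟩, ⟨v₂, l₂⟩, ⟨v₃, l₃⟩⟩ := hres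
  obtain rfl : a₂ = a₁ + 2 * u₂ := by omega
  obtain rfl : a₃ = a₁ + 2 * u₃ := by omega
  obtain rfl : b₁ = b₀ + 2 * v₁ := by omega
  obtain rfl : b₂ = b₀ + 2 * v₂ := by omega
  obtain rfl : b₃ = b₀ + 2 * v₃ := by omega
  set w₁ : ℤ := g₂ * (a₁ + 2 * u₃) - g₃ * (a₁ + 2 * u₂) with hw₁
  set w₂ : ℤ := g₃ * a₁ - g₁ * (a₁ + 2 * u₃) with hw₂
  set w₃ : ℤ := g₁ * (a₁ + 2 * u₂) - g₂ * a₁ with hw₃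
  have hsum : w₁ + w₂ + w₃ = 2 * (g₂ * u₃ - g₃ * u₂ - g₁ * u₃ + g₁ * u₂) := by
    rw [hw₁, hw₂, hw₃]; ring
  set e : ℤ := g₂ * u₃ - g₃ * u₂ - g₁ * u₃ + g₁ * u₂
  -- The commutator is 2w, so half of bw must be integral. Mod 2 every coordinate of bw is b₀(w₁ +
  -- w₂ + w₃), an even number.
  have := (quat_half_mem_lipschitz_iff
    (x₀ := -((b₀ + 2 * v₁) * w₁ + (b₀ + 2 * v₂) * w₂ + (b₀ + 2 * v₃) * w₃))
    (x₁ := b₀ * w₁ + (b₀ + 2 * v₂) * w₃ - (b₀ + 2 * v₃) * w₂)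
    (x₂ := b₀ * w₂ - (b₀ + 2 * v₁) * w₃ + (b₀ + 2 * v₃) * w₁)
    (x₃ := b₀ * w₃ + (b₀ + 2 * v₁) * w₂ - (b₀ + 2 * v₂) * w₁)).2
    ⟨⟨-(b₀ * e + v₁ * w₁ + v₂ * w₂ + v₃ * w₃), by linear_combination (-b₀) * hsum⟩,
      ⟨b₀ * e - b₀ * w₂ + v₂ * w₃ - v₃ * w₂, by linear_combination b₀ * hsum⟩,
      ⟨b₀ * e - b₀ * w₃ - v₁ * w₃ + v₃ * w₁, by linear_combination b₀ * hsum⟩,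
      ⟨b₀ * e - b₀ * w₁ + v₁ * w₂ - v₂ * w₁, by linear_combination b₀ * hsum⟩⟩
  rw [commutator_quat, quat_mul]
  convert this using 2 <;> rw [hw₁, hw₂, hw₃] <;> push_cast <;> ring

/-- Twice a multiplier being integral suffices, as Lipschitz commutators are even. -/
theorem mul_commutator_mem_of_two_mul_mem {a α γ : Quaternion ℚ}
    (ha : quat 2 0 0 0 * a ∈ lipschitz) (hα : α ∈ lipschitz) (hγ : γ ∈ lipschitz) :
    a * (γ * α - α * γ) ∈ lipschitz := by
  obtain ⟨a₀, a₁, a₂, a₃, rfl⟩ := mem_lipschitz_iff.1 hα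
  obtain ⟨g₀, g₁, g₂, g₃, rfl⟩ := mem_lipschitz_iff.1 hγ
  have := lipschitz.mul_mem ha (quat_int_mem 0 (g₂ * a₃ - g₃ * a₂) (g₃ * a₁ - g₁ * a₃)
    (g₁ * a₂ - g₂ * a₁))
  rw [commutator_quat]
  convert this using 1
  refine quat_ext ?_ ?_ ?_ ?_ <;> simp <;> ring

/-- If `a` multiplies twice a pure quaternion of norm `c` into the Lipschitz ring, then `2 * c * a`
is Lipschitz. -/
theorem norm_mul_mem {a : Quaternion ℚ} {d₁ d₂ d₃ c : ℤ} (hc : d₁ ^ 2 + d₂ ^ 2 + d₃ ^ 2 = c)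
    (ha : a * quat 0 (2 * d₁) (2 * d₂) (2 * d₃) ∈ lipschitz) :
    quat (2 * c) 0 0 0 * a ∈ lipschitz := by
  have := lipschitz.mul_mem ha (quat_int_mem 0 (-d₁) (-d₂) (-d₃))
  convert this using 1
  subst hc
  refine quat_ext ?_ ?_ ?_ ?_ <;> simp <;> ring

theorem lipschitz_comm_iff {S : Set (Quaternion ℚ)} {t n : ℤ} (hnt : S.Nontrivial)
    (hSR : S ⊆ (lipschitz : Set (Quaternion ℚ)))
    (hS : ∀ α ∈ S, 2 * α.re = t ∧ Quaternion.normSq α = n)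
    (hred : ∀ a n : ℤ, 2 ≤ n → ¬ (fun α : Quaternion ℚ => α + (a : Quaternion ℚ)) '' S ⊆
      (fun γ : Quaternion ℚ => (n : Quaternion ℚ) * γ) '' (lipschitz : Set (Quaternion ℚ))) :
    (∀ a, (∀ δ ∈ diffSet S, a * δ ∈ lipschitz) →
      ∀ α ∈ S, ∀ γ ∈ lipschitz, a * (γ * α - α * γ) ∈ lipschitz) ↔
      normGcd S = 2 ∨ normGcd S = 4 ∨ (normGcd S = 8 ∧ MeetsTwoResidues S) := by
  have hS' : ∀ α ∈ S, 2 * α.re = t := fun α hα => (hS α hα).1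
  have heven : ∀ δ ∈ diffSet S, ∃ c : ℤ, Quaternion.normSq δ = ((2 : ℕ) : ℚ) * c := fun δ hδ => by
    simpa using even_normSq_of_mem_diffSet hSR hS hδ
  have hint : ∀ δ ∈ diffSet S, ∃ c : ℤ, Quaternion.normSq δ = c := fun δ hδ => by
    obtain ⟨c, hc⟩ := heven δ hδ
    exact ⟨2 * c, by rw [hc]; push_cast; rfl⟩
  have hdvd := dvd_normGcd_iff hnt hint
  constructor
  · intro hcomm
    have hodd : ∀ p : ℕ, p.Prime → p ≠ 2 → ¬ p ∣ normGcd S := fun p hp hp2 hpd =>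
      not_odd_prime_dvd le_rfl lipschitz_le_hurwitz hSR hS' hred hcomm hp hp2 ((hdvd p).1 hpd)
    have h2 : 2 ∣ normGcd S := (hdvd 2).2 heven
    have hM : 8 ∣ normGcd S → MeetsTwoResidues S := fun h =>
      meetsTwoResidues_of_comm hnt.nonempty hSR hS' hred hcomm
        (by simpa using (hdvd 8).1 h)
    have h16 : ¬ 16 ∣ normGcd S := fun h =>
      not_sixteen_dvd_of_meetsTwoResidues hSR hS' (hM (dvd_trans (by norm_num) h))
        (by simpa using (hdvd 16).1 h)
    obtain ⟨k, hk⟩ := eq_two_pow_of_not_odd_prime_dvd (normGcd_ne_zero hnt hint) hodd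
    match k, hk with
    | 0, hk => rw [hk] at h2; norm_num at h2
    | 1, hk => exact Or.inl hk
    | 2, hk => exact Or.inr (Or.inl hk)
    | 3, hk => exact Or.inr (Or.inr ⟨hk, hM ⟨1, hk⟩⟩)
    | k + 4, hk => exact absurd ⟨2 ^ k, by rw [hk]; ring⟩ h16
  · intro hΓ a ha α hα γ hγ
    have hstar : ∀ δ ∈ diffSet S, star δ ∈ lipschitz := by
      intro δ hδ
      obtain ⟨v₁, v₂, v₃, rfl⟩ := exists_int_of_mem_diffSet lipschitz_le_hurwitz hSR hS' hδ
      convert quat_int_mem 0 (-v₁) (-v₂) (-v₃) using 1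
      refine quat_ext ?_ ?_ ?_ ?_ <;> simp
    have hΓa := quat_normGcd_mul_mem hnt hint hstar ha
    -- A difference whose norm has minimal `2`-adic valuation halves the denominator of `a`.
    have hhalf : ∀ g : ℕ, normGcd S = 4 * g → 0 < g → quat (2 * g) 0 0 0 * a ∈ lipschitz := by
      intro g hg hg0
      have hg4 : 4 ∣ normGcd S := ⟨g, hg⟩
      have hng : ¬ 2 * (4 * g) ∣ normGcd S := by
        rw [hg]
        intro h
        have := Nat.le_of_dvd (by omega) h
        omega
      rw [hdvd] at hng
      push Not at hng
      obtain ⟨δ, hδ, hδn⟩ := hng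
      obtain ⟨c, hc⟩ := (hdvd (4 * g)).1 ⟨1, by rw [hg, mul_one]⟩ δ hδ
      have hc2 : ¬ 2 ∣ c := by
        rintro ⟨e, rfl⟩
        exact hδn e (by rw [hc]; push_cast; ring)
      obtain ⟨m, rfl⟩ : ∃ m, c = 2 * m + 1 := ⟨c / 2, by omega⟩
      obtain ⟨d₁, d₂, d₃, rfl, hd⟩ := exists_two_mul_of_four_dvd hSR hS' hδ
        (c := g * (2 * m + 1)) (by rw [hc]; push_cast; ring)
      -- 2g(2m + 1)a and m·4ga both lie in L; their difference is 2ga.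
      have h1 := norm_mul_mem hd (ha _ hδ)
      have h2 := lipschitz.mul_mem (quat_int_mem m 0 0 0) hΓa
      rw [hg] at h2
      convert lipschitz.sub_mem h1 h2 using 1
      refine quat_ext ?_ ?_ ?_ ?_ <;> simp <;> ring
    -- Γ = 2 and Γ = 4 both yield 2a ∈ L. Γ = 8 yields only 4a ∈ L, and there the residues are
    -- needed.
    rcases hΓ with hΓ | hΓ | ⟨hΓ, hM⟩
    · rw [hΓ] at hΓa
      exact mul_commutator_mem_of_two_mul_mem (by simpa using hΓa) (hSR hα) hγ
    · have := hhalf 1 hΓ one_pos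
      exact mul_commutator_mem_of_two_mul_mem (by simpa using this) (hSR hα) hγ
    · have h4 := hhalf 2 hΓ two_pos
      obtain ⟨b₀, b₁, b₂, b₃, hb⟩ := mem_lipschitz_iff.1 h4
      obtain rfl : a = quat (b₀ / 4) (b₁ / 4) (b₂ / 4) (b₃ / 4) := by
        have e0 := congrArg (·.re) hb
        have e1 := congrArg (·.imI) hb
        have e2 := congrArg (·.imJ) hb
        have e3 := congrArg (·.imK) hb
        simp at e0 e1 e2 e3
        refine quat_ext ?_ ?_ ?_ ?_ <;> simp <;> linarith
      refine mul_commutator_mem_of_meetsTwoResidues hSR hS ?_ hM ha hα hγ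
      simpa using (hdvd 4).1 ⟨2, hΓ⟩

end QuatRingset

theorem mainTheorem1 (S : Set (Quaternion ℚ)) (hS : S.Nontrivial) :
    (S ⊂ (QuatRingset.lipschitz : Set (Quaternion ℚ)) →
      QuatRingset.IsReduced QuatRingset.lipschitz S →
      (QuatRingset.IsRingset QuatRingset.lipschitz S ↔
        QuatRingset.normGcd S = 2 ∨ QuatRingset.normGcd S = 4 ∨
          (QuatRingset.normGcd S = 8 ∧ QuatRingset.MeetsTwoResidues S))) ∧
    (S ⊂ (QuatRingset.hurwitz : Set (Quaternion ℚ)) →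
      QuatRingset.IsReduced QuatRingset.hurwitz S →
      (QuatRingset.IsRingset QuatRingset.hurwitz S ↔
        QuatRingset.normGcd S = 1 ∨ QuatRingset.normGcd S = 2)) := by
  constructor
  · rintro hSR ⟨⟨m, hm, hdeg, hSm⟩, hred⟩
    obtain ⟨t, n, htn⟩ := QuatRingset.exists_trace_norm hm hdeg hSm
    rw [QuatRingset.isRingset_iff htn, QuatRingset.lipschitz_comm_iff hS hSR.subset htn hred]
  · rintro hSR ⟨⟨m, hm, hdeg, hSm⟩, hred⟩
    obtain ⟨t, n, htn⟩ := QuatRingset.exists_trace_norm hm hdeg hSm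
    rw [QuatRingset.isRingset_iff htn, QuatRingset.hurwitz_comm_iff hS hSR.subset htn hred]
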